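/- **Setting.** A toy top is a rotationally symmetric rigid body moving in a homogeneous gravitational field (gravitational acceleration $1$), one point of whose axis (the tip) is constrained to a horizontal plane. Let $A,C>0$ be its moments of inertia about an axis through the center of mass perpendicular to the symmetry axis and about the symmetry axis, $s>0$ the distance from the tip to the center of mass, and $p>0$ the product of $s$ and the mass. On $\mathrm{su}(2)$ use $\langle x,y\rangle=-2\,\mathrm{Tr}(xy)$; let $k=\tfrac12\mathrm{diag}(i,-i)$ and, for $\Phi\in\mathrm{SU}(2)$, $r=\Phi k\Phi^{-1}$, $u=\langle r,k\rangle$. With $$T=\tfrac12A\langle\omega,\omega\rangle+\tfrac12(C-A)\langle\omega,r\rangle^2+\tfrac12ps\langle[r,k],\omega\rangle^2,\quad V=pu,\quad L=T-V,$$ $m=\partial L/\partial\omega$ and $\langle DL,\eta\rangle=\frac{d}{d\epsilon}L(e^{\epsilon\eta}\Phi,\omega)|_{\epsilon=0}$, a motion is a curve $\Phi=\begin{pmatrix}\alpha&\beta\\ \gamma&\delta\end{pmatrix}:\mathbb R\to\mathrm{SU}(2)$ with $$\Phi'=\omega\Phi,\qquad m'=[\omega,m]+DL .$$ Let $h=T+V$,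 $l=\langle m,k\rangle$, $n=\langle m,r\rangle$ be its first integrals. Its dynamical constants $e_1,e_2,e_3$ are the roots of $$\tfrac1p(1-u^2)\bigl(h-\tfrac{n^2}{2C}-pu\bigr)-\tfrac1{2Ap}(l-nu)^2=(u-e_1)(u-e_2)(u-e_3).$$ Suppose $e_1<e_2$ and $e_3=e_4:=\sqrt{1+A/(ps)}$ (then $-1\le e_1<e_2\le1<e_3$), and let $R(u)=4(u-e_1)(u-e_2)(u+e_3)$. Let $$\omega_1=-i\int_{e_1}^{e_2}\frac{du}{\sqrt{-R(u)}},\qquad \omega_2=\int_{e_2}^{\infty}\frac{du}{\sqrt{R(u)}}$$ be the half periods of the curve $w^2=R(u)$, and let $\wp,\zeta,\sigma$ be the Weierstrass functions of the lattice $2\omega_1\mathbb Z+2\omega_2\mathbb Z$. Set $$u(x)=\wp(x-\omega_2)+\tfrac13(e_1+e_2-e_3),\qquad w(x)=\wp'(x-\omega_2),$$ and let time $t$ and the uniformizing variable $x$ (on the imaginary axis) correspond by $t=-i\sqrt{2s}\int_0^x(u(x)+e_3)\,dx$. Put $$w_{-1}=\sqrt{2s}\,(e_3-1)\frac{l+n}{A},\qquad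 w_{+1}=\sqrt{2s}\,(e_3+1)\frac{l-n}{A},$$ and let $a$, $b$ be points of the $x$-plane with $(u,w)(a)=(-1,w_{-1})$ and $(u,w)(b)=(1,w_{+1})$. **Proposition.** Assume the initial conditions at $t=x=0$: $u=e_2$, $\alpha$ is real and nonnegative (so $\delta=\alpha$), and $\gamma$ is purely imaginary with nonnegative imaginary part (so $\beta=\gamma$). Then $w_{-1}^2=R(-1)$, $w_{+1}^2=R(1)$, each real $t$ corresponds to exactly one $x\in i\mathbb R$, and, if $A=C$, the Cayley–Klein parameters as functions of $x$ are $$\alpha=k_1e^{l_1x}\frac{\sigma(x-a)}{\sigma(x-\omega_2)},\quad \beta=k_2e^{l_2x}\frac{\sigma(x+b)}{\sigma(x+\omega_2)},\quad \gamma=k_3e^{l_3x}\frac{\sigma(x-b)}{\sigma(x-\omega_2)},\quad \delta=k_4e^{l_4x}\frac{\sigma(x+a)}{\sigma(x+\omega_2)},$$ where $$k_1=k_4=\sqrt{\frac{1+e_2}2}\,\frac{\sigma(\omega_2)}{\sigma(a)},\qquad k_2=k_3=i\sqrt{\frac{1-e_2}2}\,\frac{\sigma(\omega_2)}{\sigma(b)},$$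 $$l_1=-l_4=\frac{w_{-1}}{2(-1+e_3)}+\zeta(a-\omega_2),\qquad l_3=-l_2=\frac{w_{+1}}{2(1+e_3)}+\zeta(b-\omega_2);$$ for $\beta$ and $\gamma$ it is assumed that $e_2\ne1$ (otherwise $\sigma(b)=0$). These formulas hold for all $x\in i\mathbb R$, and also for the analytic continuation of $\alpha,\beta,\gamma,\delta$ to complex $x$. If $A\ne C$, the same holds for the entries of $\Phi(t)\,\mathrm{diag}(e^{-i\tau t/2},e^{i\tau t/2})$, $\tau=(\frac1C-\frac1A)n$, in place of those of $\Phi(t)$. -/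

import Mathlib

open scoped Matrix Topology

noncomputable section

namespace PeriodPair

/-- Weierstrass' `σ`-function of the lattice `L`. (In Lean `z / 0 = 0`, so the factor belonging to
`ℓ = 0` is `1`: the product is the usual one over the nonzero lattice points.) -/
def weierstrassSigma (L : PeriodPair) (z : ℂ) : ℂ :=
  z * ∏' ℓ : L.lattice,
    (1 - z / (ℓ : ℂ)) * Complex.exp (z / (ℓ : ℂ) + (z / (ℓ : ℂ)) ^ 2 / 2)

/-- Weierstrass' `ζ`-function of the lattice `L`. (The summand belonging to `ℓ = 0` is `1 / z`.) -/
def weierstrassZeta (L : PeriodPair) (z : ℂ) : ℂ :=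
  ∑' ℓ : L.lattice, (1 / (z - (ℓ : ℂ)) + 1 / (ℓ : ℂ) + z / (ℓ : ℂ) ^ 2)

end PeriodPair

namespace ToyTop

/-! ### The mechanical system -/

/-- Complex `2 × 2` matrices. -/
abbrev Mat := Matrix (Fin 2) (Fin 2) ℂ

/-- The Lie algebra `su(2)`: skew-hermitian matrices of trace zero. -/
def su2 : Set Mat := {X | Xᴴ = -X ∧ X.trace = 0}

/-- The scalar product `⟨x, y⟩ = -2 Tr (x y)` on `su(2)`. -/
def ip (X Y : Mat) : ℝ := (-2 * (X * Y).trace).re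

/-- The matrix commutator; on `su(2) = ℝ³` it is the cross product. -/
def br (X Y : Mat) : Mat := X * Y - Y * X

/-- The unit vector `k` pointing vertically upward. -/
def k : Mat := (1 / 2 : ℂ) • !![Complex.I, 0; 0, -Complex.I]

/-- The unit vector `r = Φ k Φ⁻¹` in the direction of the top's axis, pointing away from the tip. -/
def axis (Φ : Mat) : Mat := Φ * k * Φ⁻¹

/-- `u = ⟨r, k⟩`, the height coordinate of the axis. -/
def height (Φ : Mat) : ℝ := ip (axis Φ) k

/-- Kinetic energy of the toy top in the configuration `Φ` with angular velocity `ω` (both in the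
fixed frame). `C` and `A` are the moments of inertia about the symmetry axis and about a
perpendicular axis through the center of mass, `s` is the distance from the tip to the center of
mass and `p` is `s` times the mass. -/
def kinetic (A C p s : ℝ) (Φ ω : Mat) : ℝ :=
  1 / 2 * A * ip ω ω + 1 / 2 * (C - A) * ip ω (axis Φ) ^ 2
    + 1 / 2 * (p * s) * ip (br (axis Φ) k) ω ^ 2

/-- Potential energy (gravitational acceleration `1`). -/
def potential (p : ℝ) (Φ : Mat) : ℝ := p * height Φ

/-- The Lagrange function `T - V`. -/
def lagrangian (A C p s : ℝ) (Φ ω : Mat) : ℝ := kinetic A C p s Φ ω - potential p Φ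

/-- The total energy `T + V`. -/
def energy (A C p s : ℝ) (Φ ω : Mat) : ℝ := kinetic A C p s Φ ω + potential p Φ

/-- The momentum `m = ∂L/∂ω`. -/
def momentum (A C p s : ℝ) (Φ ω : Mat) : Mat :=
  A • ω + ((C - A) * ip ω (axis Φ)) • axis Φ
    + (p * s * ip (br (axis Φ) k) ω) • br (axis Φ) k

/-- The derivative of the Lagrange function with respect to its first argument,
`⟨DL, η⟩ = d/dε L(exp(ε η) Φ, ω)` at `ε = 0`, as a function of `η`. -/
def DL (A C p s : ℝ) (Φ ω η : Mat) : ℝ :=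
  deriv (fun ε : ℝ => lagrangian A C p s (NormedSpace.exp (ε • η) * Φ) ω) 0

/-- `Φ : ℝ → SU(2)` is a motion of the toy top with angular velocity `ω`: the equations
`Φ' = ω Φ` and `m' = [ω, m] + DL` hold (the latter, an equation in `su(2)`, is tested against
all `η ∈ su(2)`). -/
structure IsMotion (A C p s : ℝ) (Φ ω : ℝ → Mat) : Prop where
  mem : ∀ t, Φ t ∈ Matrix.specialUnitaryGroup (Fin 2) ℂ
  kinematic : ∀ t i j, HasDerivAt (fun τ => Φ τ i j) ((ω t * Φ t) i j) t
  dynamic : ∀ t, ∀ η ∈ su2,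
    HasDerivAt (fun τ => ip (momentum A C p s (Φ τ) (ω τ)) η)
      (ip (br (ω t) (momentum A C p s (Φ t) (ω t))) η + DL A C p s (Φ t) (ω t) η) t

/-- The integral `l = ⟨m, k⟩`. -/
def integralL (A C p s : ℝ) (Φ ω : Mat) : ℝ := ip (momentum A C p s Φ ω) k

/-- The integral `n = ⟨m, r⟩`. -/
def integralN (A C p s : ℝ) (Φ ω : Mat) : ℝ := ip (momentum A C p s Φ ω) (axis Φ)

/-- The cubic polynomial in `v` whose roots are the dynamical constants `e₁, e₂, e₃`, for a state
with energy `h` and momentum integrals `l`, `n`. -/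
def cubic (A C p h l n v : ℝ) : ℝ :=
  1 / p * (1 - v ^ 2) * (h - n ^ 2 / (2 * C) - p * v) - 1 / (2 * A * p) * (l - n * v) ^ 2

/-- The Cayley-Klein parameters of a motion `Φ`, seen from a frame rotating about the symmetry
axis with constant angular velocity `(1/C - 1/A) n`:
`Φ(t) diag(exp(-i τ t / 2), exp(i τ t / 2))` with `τ = (1/C - 1/A) n`. If `A = C` this is `Φ`. -/
def cayleyKlein (A C n : ℝ) (Φ : ℝ → Mat) (t : ℝ) : Mat :=
  Φ t * !![Complex.exp (-(Complex.I / 2 * (((1 / C - 1 / A) * n * t : ℝ) : ℂ))), 0;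
           0, Complex.exp (Complex.I / 2 * (((1 / C - 1 / A) * n * t : ℝ) : ℂ))]

/-! ### The elliptic curve `w² = R(u)` and its uniformization -/

/-- `R(u) = 4 (u - e₁) (u - e₂) (u + e₃)`. -/
def R (e₁ e₂ e₃ u : ℝ) : ℝ := 4 * (u - e₁) * (u - e₂) * (u + e₃)

/-- The lattice `L` has the periods `2 ω₁`, `2 ω₂` of `du / w`: integrating around the branch
points `e₁, e₂` gives `ω₁ = -i ∫_{e₁}^{e₂} du / √(-R(u))` on the negative imaginary axis, and
integrating around `e₂, ∞` gives `ω₂ = ∫_{e₂}^∞ du / √(R(u))` on the positive real axis. -/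
structure IsPeriodPair (e₁ e₂ e₃ : ℝ) (L : PeriodPair) : Prop where
  period₁ : L.ω₁ = 2 * (-Complex.I * ((∫ u in e₁..e₂, 1 / √(-R e₁ e₂ e₃ u) : ℝ) : ℂ))
  period₂ : L.ω₂ = 2 * ((∫ u in Set.Ioi e₂, 1 / √(R e₁ e₂ e₃ u) : ℝ) : ℂ)

/-- The half period `ω₂`. -/
def halfPeriod (L : PeriodPair) : ℂ := L.ω₂ / 2

/-- `u` as a function of the uniformizing variable `x = ∫_{e₂}^u du / w`. -/
def uFun (e₁ e₂ e₃ : ℝ) (L : PeriodPair) (x : ℂ) : ℂ :=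
  L.weierstrassP (x - halfPeriod L) + ((1 / 3 * (e₁ + e₂ - e₃) : ℝ) : ℂ)

/-- `w` as a function of the uniformizing variable. -/
def wFun (L : PeriodPair) (x : ℂ) : ℂ := L.derivWeierstrassP (x - halfPeriod L)

/-- The point `x` of the uniformizing plane lies over the finite point `(u₀, w₀)` of the curve. -/
structure LiesOver (e₁ e₂ e₃ : ℝ) (L : PeriodPair) (x : ℂ) (u₀ w₀ : ℝ) : Prop where
  not_pole : x - halfPeriod L ∉ L.lattice
  u_eq : uFun e₁ e₂ e₃ L x = u₀
  w_eq : wFun L x = w₀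

/-- The time `t` and the value `x = i y` of the uniformizing variable correspond to each other:
`t = -i √(2 s) ∫_0^x (u + e₃) dx`, the path of integration being the segment from `0` to `i y`. -/
def TimeAt (s e₁ e₂ e₃ : ℝ) (L : PeriodPair) (t y : ℝ) : Prop :=
  (t : ℂ) = -Complex.I * (√(2 * s) : ℂ) *
    ∫ η in (0 : ℝ)..y, (uFun e₁ e₂ e₃ L (η * Complex.I) + e₃) * Complex.I

/-- The function `g` of time is given, as a function of the uniformizing variable, by `F`:
`g(t) = F(i y)` whenever `t` and `x = i y` correspond, and `F` is also the analytic continuation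
of `g`, viewed as a function of `x` on the imaginary axis near `0`, to complex `x`. -/
def IsGivenBy (s e₁ e₂ e₃ : ℝ) (L : PeriodPair) (g : ℝ → ℂ) (F : ℂ → ℂ) : Prop :=
  (∀ t y : ℝ, TimeAt s e₁ e₂ e₃ L t y → g t = F (y * Complex.I)) ∧
  ∀ (U : Set ℂ) (f : ℂ → ℂ), IsOpen U → IsPreconnected U → (0 : ℂ) ∈ U → AnalyticOnNhd ℂ f U →
    (∀ᶠ y : ℝ in 𝓝 0, ∀ t : ℝ, TimeAt s e₁ e₂ e₃ L t y → f (y * Complex.I) = g t) →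
    Set.EqOn f F U

end ToyTop

end

/-!
The proof compares, along the imaginary axis `x = i y`, each Cayley-Klein parameter with its
proposed `σ`-quotient by means of a first-order linear differential equation that both satisfy.

*Mechanics.* In coordinates on `su(2) = ℝ³` the equations of motion give the first integrals, the
first-order equation of the height `u`, and its acceleration. The Cayley-Klein parameters satisfy
`4 conj α α' = u' + i (κ + ν)` and `4 conj γ γ' = -u' + i (ν - κ)`, where `κ` and `ν` are the
components of the angular velocity along the vertical and along the axis of the top. The rotation by
`τ t` about the axis reduces `κ + ν` to `(l + n) / A` and `ν - κ` to `-(l - n) / A`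
(`ToyTop.IsMotion.reduced`).

*Uniformization.* The points `a` and `b` lie over points of the curve with different `u`, so they
pin down `g₂` and `g₃`: the polynomials `4 ℘³ - g₂ ℘ - g₃` and `R` have the same leading
coefficients and agree at two places (`ToyTop.hasInvariants_of_liesOver`). The value of `℘` at the
half period `ω₂` follows from the integral that defines `ω₂`, since `℘` comes down from infinity on
the real axis as a solution of `℘'² = R` (`ToyTop.uFun_zero`). On the imaginary axis `u(i y)`
satisfies `d²u/dy² = -R'(u) / 2`. In the case `e₃ = e₄` the factor `A + p s (1 - u²)` of the
nutation equation is `p s (e₃² - u²)` and cancels the root `e₃` of the cubic, so that the height, as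
a function of `y`, satisfies the same equation with the same initial values
(`ToyTop.ReducedMotion.exists_timeChange`). Working with the equation of second order makes the
turning points harmless.

*The `σ`-quotients.* By `σ' = ζ σ` and the addition theorem of `ζ`
(`PeriodPair.weierstrassZeta_add`) the logarithmic derivative of `e^{λ x} σ(x - c) / σ(x - ω₂)` is
the rational expression in `u`, `w` that occurs in the equation for `α` or `γ`
(`ToyTop.hasDerivAt_sigmaQuotient`). The equation is singular where `u = ∓1`; this set is countable,
and the `σ`-quotient has only simple zeros, so the quotient of the two functions is continuous with
derivative zero off a countable set, hence constant (`eq_of_deriv_mul_eq`). The parameters `δ` and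
`β` are obtained from `α` and `γ` by complex conjugation, which amounts to replacing `x` by `-x`.
The statement on analytic continuation is the identity theorem (`ToyTop.isGivenBy_of_eq`).
-/

/-! ### The functions `σ` and `ζ` -/

namespace PeriodPair

open Filter

/-- The elementary factor `(1 - w) exp (w + w² / 2)` is `1 + O(w³)`. -/
lemma norm_elementaryFactor_sub_one_le {w : ℂ} (hw : ‖w‖ ≤ 1 / 2) :
    ‖(1 - w) * Complex.exp (w + w ^ 2 / 2) - 1‖ ≤ 10 * ‖w‖ ^ 3 := by
  set g := w + w ^ 2 / 2 with hg
  have hg1 : ‖g‖ ≤ 3 / 2 * ‖w‖ := by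
    calc ‖g‖ ≤ ‖w‖ + ‖w ^ 2 / 2‖ := norm_add_le _ _
      _ = ‖w‖ + ‖w‖ * ‖w‖ / 2 := by simp [sq]
      _ ≤ 3 / 2 * ‖w‖ := by nlinarith [norm_nonneg w]
  have hb := Complex.exp_bound (x := g) (by linarith) (n := 3) (by norm_num)
  have hs : ∑ m ∈ Finset.range 3, g ^ m / (m.factorial : ℂ) = 1 + g + g ^ 2 / 2 := by
    simp [Finset.sum_range_succ, Nat.factorial]
  rw [hs] at hb
  have hb' : ‖Complex.exp g - (1 + g + g ^ 2 / 2)‖ ≤ ‖g‖ ^ 3 := by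
    refine hb.trans ?_
    have : ‖g‖ ^ 3 * (((3 : ℕ).succ : ℝ) * (((3 : ℕ).factorial : ℝ) * (3 : ℕ))⁻¹) ≤
        ‖g‖ ^ 3 * 1 := by
      gcongr
      norm_num [Nat.factorial]
    simpa using this
  have key : (1 - w) * Complex.exp g - 1
      = (1 - w) * (Complex.exp g - (1 + g + g ^ 2 / 2))
        + w ^ 3 * (-1 / 2 - 3 / 8 * w - 1 / 8 * w ^ 2) := by
    rw [hg]; ring
  have h1 : ‖1 - w‖ ≤ 3 / 2 := by
    calc ‖1 - w‖ ≤ ‖(1 : ℂ)‖ + ‖w‖ := norm_sub_le _ _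
      _ ≤ 3 / 2 := by rw [norm_one]; linarith
  have h2 : ‖(-1 / 2 - 3 / 8 * w - 1 / 8 * w ^ 2 : ℂ)‖ ≤ 1 := by
    calc ‖(-1 / 2 - 3 / 8 * w - 1 / 8 * w ^ 2 : ℂ)‖
        ≤ ‖(-1 / 2 - 3 / 8 * w : ℂ)‖ + ‖(1 / 8 * w ^ 2 : ℂ)‖ := norm_sub_le _ _
      _ ≤ ‖(-1 / 2 : ℂ)‖ + ‖(3 / 8 * w : ℂ)‖ + ‖(1 / 8 * w ^ 2 : ℂ)‖ := by
        gcongr; exact norm_sub_le _ _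
      _ = 1 / 2 + 3 / 8 * ‖w‖ + 1 / 8 * (‖w‖ * ‖w‖) := by
        simp [sq]
      _ ≤ 1 := by nlinarith [norm_nonneg w]
  rw [key]
  calc _ ≤ ‖1 - w‖ * ‖Complex.exp g - (1 + g + g ^ 2 / 2)‖
        + ‖w ^ 3‖ * ‖(-1 / 2 - 3 / 8 * w - 1 / 8 * w ^ 2 : ℂ)‖ := by
        refine (norm_add_le _ _).trans ?_
        rw [norm_mul, norm_mul]
    _ ≤ 3 / 2 * (3 / 2 * ‖w‖) ^ 3 + ‖w‖ ^ 3 * 1 := by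
        rw [norm_pow]
        gcongr
        exact hb'.trans (by gcongr)
    _ ≤ 10 * ‖w‖ ^ 3 := by
        nlinarith [pow_nonneg (norm_nonneg w) 3]

/-- The factors of the product defining `σ`, the one belonging to `l₀` replaced by `1`. -/
noncomputable def sigmaFactor (L : PeriodPair) (l₀ l : L.lattice) (z : ℂ) : ℂ :=
  open Classical in
  if l = l₀ then 1 else
    (1 - z / (l : ℂ)) * Complex.exp (z / (l : ℂ) + (z / (l : ℂ)) ^ 2 / 2)

/-- The product over the lattice defining `σ`, without the factor belonging to `l₀`. -/
noncomputable def sigmaExcept (L : PeriodPair) (l₀ : L.lattice) (z : ℂ) : ℂ :=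
  ∏' l : L.lattice, L.sigmaFactor l₀ l z

variable (L : PeriodPair)

lemma eventually_cofinite_le_norm (r : ℝ) : ∀ᶠ l : L.lattice in cofinite, r ≤ ‖(l : ℂ)‖ := by
  refine (isCompact_iff_finite.mp (isCompact_closedBall (0 : L.lattice) r)).subset ?_
  intro l hl
  have : ‖(l : ℂ)‖ < r := by simpa using hl
  simpa using this.le

lemma summable_norm_cube : Summable fun l : L.lattice => ‖(l : ℂ)‖ ^ (-3 : ℝ) :=
  ZLattice.summable_norm_rpow _ _ (by simp; norm_num)

lemma differentiable_sigmaFactor (l₀ l : L.lattice) : Differentiable ℂ (L.sigmaFactor l₀ l) := by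
  unfold sigmaFactor
  split_ifs <;> fun_prop

lemma norm_sigmaFactor_sub_one_le (l₀ : L.lattice) {r : ℝ} (hr : 0 < r) :
    ∀ᶠ l : L.lattice in cofinite, ∀ z ∈ Metric.ball (0 : ℂ) r,
      ‖L.sigmaFactor l₀ l z - 1‖ ≤ 10 * r ^ 3 * ‖(l : ℂ)‖ ^ (-3 : ℝ) := by
  filter_upwards [L.eventually_cofinite_le_norm (2 * r)] with l hl z hz
  have hz : ‖z‖ < r := by simpa using hz
  have hl0 : 0 < ‖(l : ℂ)‖ := by linarith
  have e : ‖(l : ℂ)‖ ^ (-3 : ℝ) = (‖(l : ℂ)‖ ^ 3)⁻¹ := by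
    rw [Real.rpow_neg hl0.le, ← Real.rpow_natCast]; norm_num only [Nat.cast_ofNat]
  unfold sigmaFactor
  split_ifs
  · rw [e]; simp; positivity
  · have hw : ‖z / (l : ℂ)‖ ≤ 1 / 2 := by
      rw [norm_div, div_le_iff₀ hl0]; linarith
    refine (norm_elementaryFactor_sub_one_le hw).trans ?_
    rw [e, norm_div, div_pow, div_eq_mul_inv, mul_assoc]
    gcongr

lemma hasProdLocallyUniformlyOn_sigmaFactor (l₀ : L.lattice) {r : ℝ} (hr : 0 < r) :
    HasProdLocallyUniformlyOn (L.sigmaFactor l₀) (L.sigmaExcept l₀) (Metric.ball 0 r) := by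
  have := Summable.hasProdLocallyUniformlyOn_one_add (f := fun l z => L.sigmaFactor l₀ l z - 1)
    (K := Metric.ball (0 : ℂ) r) Metric.isOpen_ball
    (u := fun l : L.lattice => 10 * r ^ 3 * ‖(l : ℂ)‖ ^ (-3 : ℝ))
    (hu := L.summable_norm_cube.mul_left _) (L.norm_sigmaFactor_sub_one_le l₀ hr)
    (fun l => ((L.differentiable_sigmaFactor l₀ l).sub_const 1).continuous.continuousOn)
  simpa [sigmaExcept] using! this

lemma differentiable_sigmaExcept (l₀ : L.lattice) : Differentiable ℂ (L.sigmaExcept l₀) := by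
  intro z
  have hr : (0 : ℝ) < ‖z‖ + 1 := by positivity
  refine ((L.hasProdLocallyUniformlyOn_sigmaFactor l₀ hr).differentiableOn
    (.of_forall fun s => ?_) Metric.isOpen_ball).differentiableAt
    (Metric.isOpen_ball.mem_nhds (by simp))
  simpa [Finset.prod_fn] using DifferentiableOn.finsetProd
    (fun l _ => (L.differentiable_sigmaFactor l₀ l).differentiableOn)

lemma sigmaFactor_ne_zero {l₀ : L.lattice} {z : ℂ} (hz : ∀ l : L.lattice, l ≠ l₀ → z ≠ l)
    (l : L.lattice) : L.sigmaFactor l₀ l z ≠ 0 := by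
  unfold sigmaFactor
  split_ifs with h
  · simp
  · refine mul_ne_zero ?_ (Complex.exp_ne_zero _)
    rw [sub_ne_zero]
    intro e
    rcases eq_or_ne (l : ℂ) 0 with h0 | h0
    · simp [h0] at e
    · rw [eq_comm, div_eq_one_iff_eq h0] at e
      exact hz l h e

lemma sigmaExcept_ne_zero {l₀ : L.lattice} {z : ℂ} (hz : ∀ l : L.lattice, l ≠ l₀ → z ≠ l) :
    L.sigmaExcept l₀ z ≠ 0 := by
  have hr : (0 : ℝ) < ‖z‖ + 1 := by positivity
  have hs : Summable fun l : L.lattice => ‖L.sigmaFactor l₀ l z - 1‖ := by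
    refine Summable.of_norm_bounded_eventually
      (L.summable_norm_cube.mul_left (10 * (‖z‖ + 1) ^ 3)) ?_
    filter_upwards [L.norm_sigmaFactor_sub_one_le l₀ hr] with l hl
    simpa using hl z (by simp)
  have := tprod_one_add_ne_zero_of_summable (f := fun l => L.sigmaFactor l₀ l z - 1)
    (fun l => by simpa using L.sigmaFactor_ne_zero hz l) hs
  simpa [sigmaExcept] using this

lemma weierstrassSigma_eq (z : ℂ) : L.weierstrassSigma z = z * L.sigmaExcept 0 z := by
  rw [weierstrassSigma, sigmaExcept]
  congr 1
  refine tprod_congr fun l => ?_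
  unfold sigmaFactor
  split_ifs with h
  · simp [h]
  · rfl

lemma weierstrassSigma_eq_of_ne {l₀ : L.lattice} (h₀ : l₀ ≠ 0) (z : ℂ) :
    L.weierstrassSigma z = z * ((1 - z / (l₀ : ℂ)) *
      Complex.exp (z / (l₀ : ℂ) + (z / (l₀ : ℂ)) ^ 2 / 2) * L.sigmaExcept l₀ z) := by
  classical
  have hr : (0 : ℝ) < ‖z‖ + 1 := by positivity
  rw [weierstrassSigma, sigmaExcept]
  congr 1
  have hm := ((L.hasProdLocallyUniformlyOn_sigmaFactor l₀ hr).hasProd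
    (x := z) (by simp)).multipliable
  have hu : (fun l : L.lattice => L.sigmaFactor l₀ l z) = Function.update
      (fun l : L.lattice => (1 - z / (l : ℂ)) * Complex.exp (z / (l : ℂ) + (z / (l : ℂ)) ^ 2 / 2))
      l₀ 1 := by
    ext l
    by_cases h : l = l₀
    · subst h; simp [sigmaFactor]
    · simp [sigmaFactor, h]
  rw [hu] at hm
  rw [Multipliable.tprod_eq_mul_tprod_ite' l₀ hm]
  rfl

lemma differentiable_weierstrassSigma : Differentiable ℂ L.weierstrassSigma := by
  have : L.weierstrassSigma = fun z => z * L.sigmaExcept 0 z := funext L.weierstrassSigma_eq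
  rw [this]
  exact differentiable_id.mul (L.differentiable_sigmaExcept 0)

lemma weierstrassSigma_ne_zero {z : ℂ} (hz : z ∉ L.lattice) : L.weierstrassSigma z ≠ 0 := by
  rw [weierstrassSigma_eq]
  refine mul_ne_zero ?_ (L.sigmaExcept_ne_zero ?_)
  · rintro rfl; exact hz (zero_mem _)
  · rintro l - rfl; exact hz l.2

lemma weierstrassSigma_eq_zero {z : ℂ} (hz : z ∈ L.lattice) : L.weierstrassSigma z = 0 := by
  rcases eq_or_ne z 0 with rfl | h0
  · simp [weierstrassSigma]
  · rw [L.weierstrassSigma_eq_of_ne (l₀ := ⟨z, hz⟩) (by simpa [← Subtype.coe_inj] using h0)]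
    simp [h0]

lemma weierstrassSigma_eq_zero_iff {z : ℂ} : L.weierstrassSigma z = 0 ↔ z ∈ L.lattice :=
  ⟨fun h => by by_contra hz; exact L.weierstrassSigma_ne_zero hz h, L.weierstrassSigma_eq_zero⟩

/-- The zeros of `σ` are simple. -/
lemma deriv_weierstrassSigma_ne_zero {z : ℂ} (hz : z ∈ L.lattice) :
    deriv L.weierstrassSigma z ≠ 0 := by
  have hne := L.sigmaExcept_ne_zero (l₀ := ⟨z, hz⟩) (z := z)
    (fun l hl e => hl (Subtype.ext e.symm))
  have hd := (L.differentiable_sigmaExcept ⟨z, hz⟩ z).hasDerivAt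
  rcases eq_or_ne z 0 with rfl | h0
  · have : L.weierstrassSigma = fun z => z * L.sigmaExcept 0 z := funext L.weierstrassSigma_eq
    have hm : HasDerivAt (fun z => z * L.sigmaExcept 0 z) _ 0 := (hasDerivAt_id (0 : ℂ)).mul hd
    rw [this, hm.deriv]
    simpa using! hne
  · have h0' : (⟨z, hz⟩ : L.lattice) ≠ 0 := by simpa [← Subtype.coe_inj] using h0
    rw [funext (L.weierstrassSigma_eq_of_ne h0')]
    have h1 : HasDerivAt (fun x : ℂ => 1 - x / z) (-(1 / z)) z :=
      ((hasDerivAt_id z).div_const z).const_sub 1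
    have h2 : DifferentiableAt ℂ (fun x : ℂ => Complex.exp (x / z + (x / z) ^ 2 / 2)) z := by
      fun_prop
    have hm : HasDerivAt (fun x => x * ((1 - x / z) *
        Complex.exp (x / z + (x / z) ^ 2 / 2) * L.sigmaExcept ⟨z, hz⟩ x)) _ z :=
      (hasDerivAt_id z).mul ((h1.mul h2.hasDerivAt).mul hd)
    rw [hm.deriv]
    simp [h0, hne, Complex.exp_ne_zero]

lemma weierstrassSigma_neg (z : ℂ) : L.weierstrassSigma (-z) = -L.weierstrassSigma z := by
  simp only [weierstrassSigma]
  rw [← (Equiv.neg L.lattice).tprod_eq]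
  simp [neg_div_neg_eq]

lemma weierstrassZeta_neg (z : ℂ) : L.weierstrassZeta (-z) = -L.weierstrassZeta z := by
  simp only [weierstrassZeta]
  rw [← (Equiv.neg L.lattice).tsum_eq, ← tsum_neg]
  refine tsum_congr fun l => ?_
  have : (-z - -(l : ℂ)) = -(z - l) := by ring
  simp only [Equiv.neg_apply, Submodule.coe_neg, this, one_div, inv_neg, neg_sq, neg_div]
  ring

lemma hasSumLocallyUniformly_weierstrassZeta :
    HasSumLocallyUniformly
      (fun (l : L.lattice) (z : ℂ) => 1 / (z - (l : ℂ)) + 1 / (l : ℂ) + z / (l : ℂ) ^ 2)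
      L.weierstrassZeta := by
  refine L.hasSumLocallyUniformly_aux (u := fun r l => 2 * r ^ 2 * ‖(l : ℂ)‖ ^ (-3 : ℝ)) _
    (fun _ _ => L.summable_norm_cube.mul_left _) fun r hr =>
    Filter.eventually_atTop.mpr ⟨2 * r, ?_⟩
  rintro _ h z hz l rfl
  have hl0 : 0 < ‖(l : ℂ)‖ := by linarith
  have hl : (l : ℂ) ≠ 0 := norm_pos_iff.mp hl0
  have hzl : ‖(l : ℂ)‖ / 2 ≤ ‖z - l‖ := by
    have := norm_sub_norm_le (l : ℂ) z
    rw [norm_sub_rev] at this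
    linarith
  have hzl0 : z - (l : ℂ) ≠ 0 := norm_pos_iff.mp (by linarith)
  have e : ‖(l : ℂ)‖ ^ (-3 : ℝ) = (‖(l : ℂ)‖ ^ 3)⁻¹ := by
    rw [Real.rpow_neg hl0.le, ← Real.rpow_natCast]; norm_num only [Nat.cast_ofNat]
  have e2 : 1 / (z - (l : ℂ)) + 1 / (l : ℂ) + z / (l : ℂ) ^ 2
      = z ^ 2 / ((l : ℂ) ^ 2 * (z - l)) := by
    field_simp; ring
  rw [e2, e, norm_div, norm_mul, norm_pow, norm_pow, div_le_iff₀ (by positivity)]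
  calc ‖z‖ ^ 2 ≤ r ^ 2 := by gcongr
    _ = 2 * r ^ 2 * (‖(l : ℂ)‖ ^ 3)⁻¹ * (‖(l : ℂ)‖ ^ 2 * (‖(l : ℂ)‖ / 2)) := by field_simp
    _ ≤ _ := by gcongr

lemma logDeriv_sigmaFactor_zero {l : L.lattice} {z : ℂ} (hz : z ∉ L.lattice) :
    logDeriv (L.sigmaFactor 0 l) z =
      open Classical in if l = 0 then 0 else
        1 / (z - (l : ℂ)) + 1 / (l : ℂ) + z / (l : ℂ) ^ 2 := by
  by_cases h : l = 0
  · have : L.sigmaFactor 0 l = fun _ => 1 := by funext z; simp [sigmaFactor, h]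
    rw [this, if_pos h]
    simp [logDeriv_apply]
  · have hl : (l : ℂ) ≠ 0 := by simpa using h
    have hzl : z - l ≠ 0 := by
      rw [sub_ne_zero]; rintro rfl; exact hz l.2
    have : L.sigmaFactor 0 l = fun z =>
        (1 - z / (l : ℂ)) * Complex.exp (z / (l : ℂ) + (z / (l : ℂ)) ^ 2 / 2) := by
      funext z; simp [sigmaFactor, h]
    have h1 : HasDerivAt (fun x : ℂ => 1 - x / l) (-(1 / l)) z :=
      ((hasDerivAt_id z).div_const _).const_sub 1
    have h2 : HasDerivAt (fun x : ℂ => x / l + (x / l) ^ 2 / 2)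
        (1 / l + (2 * (z / l) ^ 1 * (1 / l)) / 2) z :=
      ((hasDerivAt_id z).div_const (l : ℂ)).add
        ((((hasDerivAt_id z).div_const (l : ℂ)).pow 2).div_const 2)
    have hlz : (l : ℂ) - z ≠ 0 := by rw [← neg_sub]; exact neg_ne_zero.mpr hzl
    have hm : HasDerivAt (fun z : ℂ =>
        (1 - z / (l : ℂ)) * Complex.exp (z / (l : ℂ) + (z / (l : ℂ)) ^ 2 / 2)) _ z := h1.mul h2.cexp
    rw [logDeriv_apply, this, hm.deriv, if_neg h,
      div_eq_iff (mul_ne_zero (by field_simp; exact div_ne_zero hlz hl) (Complex.exp_ne_zero _))]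
    field_simp
    ring

lemma logDeriv_sigmaExcept_zero {z : ℂ} (hz : z ∉ L.lattice) :
    logDeriv (L.sigmaExcept 0) z = L.weierstrassZeta z - 1 / z := by
  classical
  have hr : (0 : ℝ) < ‖z‖ + 1 := by positivity
  have hs : HasSum (fun l : L.lattice => 1 / (z - (l : ℂ)) + 1 / (l : ℂ) + z / (l : ℂ) ^ 2)
      (L.weierstrassZeta z) := L.hasSumLocallyUniformly_weierstrassZeta.hasSum
  have hs' := hasSum_ite_sub_hasSum hs 0
  have hl : (fun l : L.lattice => logDeriv (L.sigmaFactor 0 l) z) =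
      fun l : L.lattice => if l = 0 then 0 else
        1 / (z - (l : ℂ)) + 1 / (l : ℂ) + z / (l : ℂ) ^ 2 := by
    funext l
    rw [L.logDeriv_sigmaFactor_zero hz]
  have hne : ∀ l : L.lattice, l ≠ 0 → z ≠ l := by rintro l - rfl; exact hz l.2
  have := logDeriv_tprod_eq_tsum (f := L.sigmaFactor 0) (s := Metric.ball (0 : ℂ) (‖z‖ + 1))
    Metric.isOpen_ball (x := z) (by simp) (L.sigmaFactor_ne_zero hne)
    (fun l => (L.differentiable_sigmaFactor 0 l).differentiableOn)
    (by rw [hl]; exact hs'.summable)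
    (L.hasProdLocallyUniformlyOn_sigmaFactor 0 hr).multipliableLocallyUniformlyOn
    (L.sigmaExcept_ne_zero hne)
  change logDeriv (fun z => ∏' l : L.lattice, L.sigmaFactor 0 l z) z = _
  rw [this, hl, hs'.tsum_eq]
  simp

/-- `σ' = ζ σ`. -/
lemma hasDerivAt_weierstrassSigma {z : ℂ} (hz : z ∉ L.lattice) :
    HasDerivAt L.weierstrassSigma (L.weierstrassZeta z * L.weierstrassSigma z) z := by
  have hz0 : z ≠ 0 := by rintro rfl; exact hz (zero_mem _)
  have hne := L.sigmaExcept_ne_zero (l₀ := 0) (z := z) (by rintro l - rfl; exact hz l.2)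
  have h := L.logDeriv_sigmaExcept_zero hz
  rw [logDeriv_apply, div_eq_iff hne] at h
  have hd := (L.differentiable_sigmaExcept 0 z).hasDerivAt
  rw [h] at hd
  have hm := (hasDerivAt_id z).mul hd
  rw [funext L.weierstrassSigma_eq]
  refine hm.congr_deriv ?_
  simp only [id]
  field_simp
  ring

/-- `ζ' = -℘`. -/
lemma hasDerivAt_weierstrassZeta {z : ℂ} (hz : z ∉ L.lattice) :
    HasDerivAt L.weierstrassZeta (-L.weierstrassP z) z := by
  have ho : IsOpen ((L.lattice : Set ℂ)ᶜ) := L.isClosed_lattice.isOpen_compl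
  have hF : TendstoLocallyUniformlyOn
      (fun s : Finset L.lattice => fun z : ℂ =>
        ∑ l ∈ s, (1 / (z - (l : ℂ)) + 1 / (l : ℂ) + z / (l : ℂ) ^ 2))
      L.weierstrassZeta atTop ((L.lattice : Set ℂ)ᶜ) :=
    L.hasSumLocallyUniformly_weierstrassZeta.tendstoLocallyUniformlyOn
  have hterm : ∀ l : L.lattice, ∀ x ∈ ((L.lattice : Set ℂ)ᶜ),
      HasDerivAt (fun z : ℂ => 1 / (z - (l : ℂ)) + 1 / (l : ℂ) + z / (l : ℂ) ^ 2)
        (-(1 / (x - l) ^ 2 - 1 / (l : ℂ) ^ 2)) x := by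
    intro l x hx
    have hxl : x - l ≠ 0 := by
      rw [sub_ne_zero]; rintro rfl; exact hx l.2
    have h3 : HasDerivAt (fun z : ℂ => (z - (l : ℂ))⁻¹ + 1 / (l : ℂ) + z / (l : ℂ) ^ 2) _ x :=
      ((((hasDerivAt_id x).sub_const (l : ℂ)).inv hxl).add_const (1 / (l : ℂ))).add
        ((hasDerivAt_id x).div_const ((l : ℂ) ^ 2))
    simp only [one_div (_ - _)]
    refine h3.congr_deriv ?_
    simp only [id]
    ring
  have hterms : ∀ s : Finset L.lattice, ∀ x ∈ ((L.lattice : Set ℂ)ᶜ),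
      HasDerivAt (fun z : ℂ => ∑ l ∈ s, (1 / (z - (l : ℂ)) + 1 / (l : ℂ) + z / (l : ℂ) ^ 2))
        (∑ l ∈ s, -(1 / (x - l) ^ 2 - 1 / (l : ℂ) ^ 2)) x :=
    fun s x hx => HasDerivAt.fun_sum fun l _ => hterm l x hx
  have hdiff : ∀ s : Finset L.lattice, DifferentiableOn ℂ
      (fun z : ℂ => ∑ l ∈ s, (1 / (z - (l : ℂ)) + 1 / (l : ℂ) + z / (l : ℂ) ^ 2))
      ((L.lattice : Set ℂ)ᶜ) :=
    fun s x hx => (hterms s x hx).differentiableAt.differentiableWithinAt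
  have hd := ((hF.deriv (.of_forall hdiff) ho).tendsto_at (a := z) hz).congr
    fun s => (hterms s z hz).deriv
  have hP := (L.hasSum_weierstrassP z).neg
  rw [← tendsto_nhds_unique hd hP]
  exact ((hF.differentiableOn (.of_forall hdiff) ho).differentiableAt
    (ho.mem_nhds hz)).hasDerivAt

lemma tendsto_weierstrassZeta_sub_inv :
    Tendsto (fun z => L.weierstrassZeta z - 1 / z) (𝓝[≠] 0) (𝓝 0) := by
  have hne := L.sigmaExcept_ne_zero (l₀ := 0) (z := 0) (fun l hl e => hl (Subtype.ext e.symm))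
  have hd0 : deriv (L.sigmaExcept 0) 0 = 0 := by
    have heven : (fun z => L.sigmaExcept 0 (-z)) = L.sigmaExcept 0 := by
      funext z
      simp only [sigmaExcept]
      rw [← (Equiv.neg L.lattice).tprod_eq]
      refine tprod_congr fun l => ?_
      by_cases h : l = 0 <;> simp [sigmaFactor, h, neg_div_neg_eq]
    have := deriv_comp_neg (L.sigmaExcept 0) 0
    rw [heven, neg_zero] at this
    exact self_eq_neg.mp this
  have hc : ContinuousAt (logDeriv (L.sigmaExcept 0)) 0 := by
    unfold logDeriv
    exact ((L.differentiable_sigmaExcept 0).contDiff.continuous_deriv le_top).continuousAt.div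
      (L.differentiable_sigmaExcept 0).continuous.continuousAt hne
  have h0 : logDeriv (L.sigmaExcept 0) 0 = 0 := by simp [logDeriv_apply, hd0]
  have ht := hc.tendsto.mono_left (nhdsWithin_le_nhds (s := {0}ᶜ))
  rw [h0] at ht
  refine ht.congr' ?_
  have hmem := L.compl_lattice_sdiff_singleton_mem_nhds 0
  filter_upwards [self_mem_nhdsWithin, mem_nhdsWithin_of_mem_nhds hmem] with z hz hz2
  refine L.logDeriv_sigmaExcept_zero fun h => hz2 ⟨h, hz⟩

end PeriodPair

/-! ### The functions `℘` and `℘'` and the addition theorem of `ζ` -/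

/-- The zeros of an analytic function that does not vanish identically on a connected set are
countable. -/
lemma AnalyticOnNhd.countable_zeros {f : ℂ → ℂ} {U : Set ℂ} (hf : AnalyticOnNhd ℂ f U)
    (hU : IsConnected U) {x : ℂ} (hx : x ∈ U) (hfx : f x ≠ 0) : {z ∈ U | f z = 0}.Countable := by
  have h := hf.preimage_zero_mem_codiscreteWithin hfx hx hU
  have hd : IsDiscrete ({z | f z = 0} ∩ U) := isDiscrete_of_codiscreteWithin h
  have : DiscreteTopology ↥({z | f z = 0} ∩ U) := hd.to_subtype
  have hc : ({z | f z = 0} ∩ U).Countable :=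
    Set.countable_coe_iff.mp (countable_of_Lindelof_of_discrete (X := ↥({z | f z = 0} ∩ U)))
  rwa [Set.inter_comm] at hc

namespace PeriodPair

open Filter

variable (L : PeriodPair)

lemma countable_lattice : (L.lattice : Set ℂ).Countable :=
  Set.countable_coe_iff.mp (countable_of_Lindelof_of_discrete (X := L.lattice))

lemma isConnected_compl_lattice : IsConnected ((L.lattice : Set ℂ)ᶜ) :=
  L.countable_lattice.isConnected_compl_of_one_lt_rank (by simp)

lemma isOpen_compl_lattice : IsOpen ((L.lattice : Set ℂ)ᶜ) := L.isClosed_lattice.isOpen_compl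

lemma hasDerivAt_weierstrassP {z : ℂ} (hz : z ∉ L.lattice) :
    HasDerivAt L.weierstrassP (L.derivWeierstrassP z) z := by
  rw [← L.deriv_weierstrassP]
  exact (L.differentiableOn_weierstrassP.differentiableAt
    (L.isOpen_compl_lattice.mem_nhds hz)).hasDerivAt

lemma differentiableAt_derivWeierstrassP {z : ℂ} (hz : z ∉ L.lattice) :
    DifferentiableAt ℂ L.derivWeierstrassP z :=
  L.differentiableOn_derivWeierstrassP.differentiableAt (L.isOpen_compl_lattice.mem_nhds hz)

lemma weierstrassP_eq_inv_sq_add (z : ℂ) :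
    L.weierstrassP z = 1 / z ^ 2 + L.weierstrassPExcept 0 z := by
  rw [← L.weierstrassPExcept_add 0 z]
  simp [add_comm]

lemma derivWeierstrassP_eq_inv_cube_add (z : ℂ) :
    L.derivWeierstrassP z = -2 / z ^ 3 + L.derivWeierstrassPExcept 0 z := by
  have := L.derivWeierstrassPExcept_sub 0 z
  rw [← this]
  simp
  ring

lemma tendsto_sq_mul_weierstrassP :
    Tendsto (fun z => z ^ 2 * L.weierstrassP z) (𝓝[≠] 0) (𝓝 1) := by
  have hc : ContinuousAt (fun z => 1 + z ^ 2 * L.weierstrassPExcept 0 z) 0 := by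
    have := (L.analyticAt_weierstrassPExcept 0).continuousAt
    fun_prop
  have ht := hc.tendsto.mono_left (nhdsWithin_le_nhds (s := {0}ᶜ))
  simp only [ne_eq, OfNat.ofNat_ne_zero, not_false_eq_true, zero_pow, zero_mul, add_zero] at ht
  refine ht.congr' ?_
  filter_upwards [self_mem_nhdsWithin] with z hz
  have hz : z ≠ 0 := hz
  rw [L.weierstrassP_eq_inv_sq_add]
  field_simp

lemma eventually_notMem_lattice : ∀ᶠ z in 𝓝[≠] (0 : ℂ), z ∉ L.lattice := by
  filter_upwards [self_mem_nhdsWithin,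
    mem_nhdsWithin_of_mem_nhds (L.compl_lattice_sdiff_singleton_mem_nhds 0)] with z hz hz2 h
  exact hz2 ⟨h, hz⟩

/-- Since `℘` has a pole at `0`, it differs somewhere from any function that stays bounded there. -/
lemma exists_weierstrassP_ne {g : ℂ → ℂ} (hg : ContinuousAt g 0) {U : Set ℂ}
    (hU : ∀ᶠ z in 𝓝[≠] (0 : ℂ), z ∈ U) : ∃ z ∈ U, L.weierstrassP z - g z ≠ 0 := by
  by_contra! h
  have h1 : Tendsto (fun z => z ^ 2 * g z) (𝓝[≠] 0) (𝓝 0) := by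
    have hc : ContinuousAt (fun z => z ^ 2 * g z) 0 := by fun_prop
    have := hc.tendsto.mono_left (nhdsWithin_le_nhds (s := {0}ᶜ))
    simpa using this
  have h2 := L.tendsto_sq_mul_weierstrassP
  refine one_ne_zero (tendsto_nhds_unique (h2.congr' ?_) h1)
  filter_upwards [hU] with z hz
  rw [sub_eq_zero.mp (h z hz)]

lemma countable_weierstrassP_eq (v : ℂ) : {z | L.weierstrassP z = v}.Countable := by
  obtain ⟨x, hx, hne⟩ := L.exists_weierstrassP_ne (g := fun _ => v) continuousAt_const
    (U := (L.lattice : Set ℂ)ᶜ) L.eventually_notMem_lattice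
  have := AnalyticOnNhd.countable_zeros (f := fun z => L.weierstrassP z - v)
    (L.analyticOnNhd_weierstrassP.sub analyticOnNhd_const) L.isConnected_compl_lattice hx hne
  refine (this.union L.countable_lattice).mono fun z hz => ?_
  by_cases h : z ∈ L.lattice
  · exact Or.inr h
  · exact Or.inl ⟨h, sub_eq_zero.mpr hz⟩

/-- `℘'' = 6 ℘² - g₂ / 2`. -/
lemma hasDerivAt_derivWeierstrassP {z : ℂ} (hz : z ∉ L.lattice) :
    HasDerivAt L.derivWeierstrassP (6 * L.weierstrassP z ^ 2 - L.g₂ / 2) z := by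
  have hd := (L.differentiableAt_derivWeierstrassP hz).hasDerivAt
  have hf := L.analyticOnNhd_derivWeierstrassP
  have hg : AnalyticOnNhd ℂ (fun z => deriv L.derivWeierstrassP z
      - (6 * L.weierstrassP z ^ 2 - L.g₂ / 2)) ((L.lattice : Set ℂ)ᶜ) :=
    hf.deriv.sub ((analyticOnNhd_const.mul (L.analyticOnNhd_weierstrassP.pow 2)).sub
      analyticOnNhd_const)
  -- differentiate `℘'² = 4 ℘³ - g₂ ℘ - g₃` and cancel `2 ℘'`
  have hfg : ∀ x ∈ ((L.lattice : Set ℂ)ᶜ), L.derivWeierstrassP x *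
      (deriv L.derivWeierstrassP x - (6 * L.weierstrassP x ^ 2 - L.g₂ / 2)) = 0 := by
    intro x hx
    have h1 := (L.differentiableAt_derivWeierstrassP hx).hasDerivAt
    have h2 := L.hasDerivAt_weierstrassP hx
    have h3 := h1.pow 2
    have h4 := (((h2.pow 3).const_mul 4).sub (h2.const_mul L.g₂)).sub_const L.g₃
    have heq : (fun z => 4 * L.weierstrassP z ^ 3 - L.g₂ * L.weierstrassP z - L.g₃) =ᶠ[𝓝 x]
        (fun z => L.derivWeierstrassP z ^ 2) := by
      filter_upwards [L.isOpen_compl_lattice.mem_nhds hx] with y hy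
      exact (L.derivWeierstrassP_sq y hy).symm
    have h5 := h3.unique (h4.congr_of_eventuallyEq heq.symm)
    push_cast at h5
    linear_combination h5 / 2
  rcases hf.eq_zero_or_eq_zero_of_mul_eq_zero hg hfg L.isConnected_compl_lattice.isPreconnected
    with h | h
  · exfalso
    have hconst : ∀ x ∈ ((L.lattice : Set ℂ)ᶜ), L.weierstrassP x = L.weierstrassP z := by
      intro x hx
      refine L.isOpen_compl_lattice.is_const_of_deriv_eq_zero
        L.isConnected_compl_lattice.isPreconnected L.differentiableOn_weierstrassP ?_ hx hz
      intro y hy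
      rw [L.deriv_weierstrassP]
      exact h y hy
    obtain ⟨x, hx, hne⟩ := L.exists_weierstrassP_ne (g := fun _ => L.weierstrassP z)
      continuousAt_const (U := (L.lattice : Set ℂ)ᶜ) L.eventually_notMem_lattice
    exact hne (sub_eq_zero.mpr (hconst x hx))
  · rw [← sub_eq_zero.mp (h z hz)]
    exact hd

/-- The quotient `(℘'(x) - ℘'(y)) / (2 (℘(x) - ℘(y)))` of the addition theorems. -/
noncomputable def addQuotient (x y : ℂ) : ℂ :=
  (L.derivWeierstrassP x - L.derivWeierstrassP y) / (2 * (L.weierstrassP x - L.weierstrassP y))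

/-- Along a line `x + y = c` the derivative of the addition quotient is `℘(x) - ℘(y)`; this is
the differential equation of `℘`. -/
lemma hasDerivAt_addQuotient {c x : ℂ} (hx : x ∉ L.lattice) (hy : c - x ∉ L.lattice)
    (hne : L.weierstrassP x ≠ L.weierstrassP (c - x)) :
    HasDerivAt (fun x => L.addQuotient x (c - x))
      (L.weierstrassP x - L.weierstrassP (c - x)) x := by
  have hP := L.hasDerivAt_weierstrassP hx
  have hP' := L.hasDerivAt_derivWeierstrassP hx
  have hQ := (L.hasDerivAt_weierstrassP hy).comp_const_sub c x
  have hQ' := (L.hasDerivAt_derivWeierstrassP hy).comp_const_sub c x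
  have e1 := L.derivWeierstrassP_sq x hx
  have e2 := L.derivWeierstrassP_sq (c - x) hy
  have hd : L.weierstrassP x - L.weierstrassP (c - x) ≠ 0 := sub_ne_zero.mpr hne
  have h := (hP'.sub hQ').div ((hP.sub hQ).const_mul 2) (mul_ne_zero two_ne_zero hd)
  refine h.congr_deriv ?_
  simp only [Pi.sub_apply]
  rw [div_eq_iff (pow_ne_zero 2 (mul_ne_zero two_ne_zero hd))]
  linear_combination (-2 : ℂ) * e1 + 2 * e2

lemma tendsto_addQuotient {c : ℂ} (hc : c ∉ L.lattice) :
    Tendsto (fun x => L.addQuotient x (c - x) + 1 / x) (𝓝[≠] 0) (𝓝 0) := by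
  have h0 := (L.analyticAt_weierstrassPExcept 0).continuousAt
  have h1 := (L.analyticAt_derivWeierstrassPExcept 0).continuousAt
  have hsub : ContinuousAt (fun x => c - x) 0 := by fun_prop
  have h2 : ContinuousAt (fun x => L.weierstrassP (c - x)) 0 :=
    ContinuousAt.comp (g := L.weierstrassP)
      (by simpa using (L.hasDerivAt_weierstrassP hc).continuousAt) hsub
  have h3 : ContinuousAt (fun x => L.derivWeierstrassP (c - x)) 0 :=
    ContinuousAt.comp (g := L.derivWeierstrassP)
      (by simpa using (L.hasDerivAt_derivWeierstrassP hc).continuousAt) hsub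
  set D := fun x => 1 + x ^ 2 * (L.weierstrassPExcept 0 x - L.weierstrassP (c - x)) with hD
  have hDc : ContinuousAt D 0 := by fun_prop
  have hD0 : D 0 = 1 := by simp [hD]
  have hq : ContinuousAt (fun x => (x * (L.weierstrassPExcept 0 x - L.weierstrassP (c - x))
      + x ^ 2 * (L.derivWeierstrassPExcept 0 x - L.derivWeierstrassP (c - x)) / 2) / D x) 0 :=
    ContinuousAt.div (by fun_prop) hDc (by rw [hD0]; exact one_ne_zero)
  have ht := hq.tendsto.mono_left (nhdsWithin_le_nhds (s := {0}ᶜ))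
  simp only [zero_mul, ne_eq, OfNat.ofNat_ne_zero, not_false_eq_true, zero_pow, zero_div,
    add_zero] at ht
  refine ht.congr' ?_
  filter_upwards [self_mem_nhdsWithin,
    mem_nhdsWithin_of_mem_nhds (hDc.eventually_ne (by rw [hD0]; exact one_ne_zero))] with x hx hDx
  have hx : x ≠ 0 := hx
  have e1 := L.weierstrassP_eq_inv_sq_add x
  have e2 := L.derivWeierstrassP_eq_inv_cube_add x
  have hden : L.weierstrassP x - L.weierstrassP (c - x) = D x / x ^ 2 := by
    rw [e1, hD]; field_simp; ring
  rw [addQuotient, hden, e2]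
  rw [hD] at hDx ⊢
  field_simp
  ring

/-- The addition theorem of `ζ`. -/
theorem weierstrassZeta_add {x y : ℂ} (hx : x ∉ L.lattice) (hy : y ∉ L.lattice)
    (hxy : x + y ∉ L.lattice) (hne : L.weierstrassP x ≠ L.weierstrassP y) :
    L.weierstrassZeta (x + y) = L.weierstrassZeta x + L.weierstrassZeta y + L.addQuotient x y := by
  obtain ⟨c, rfl⟩ : ∃ c, y = c - x := ⟨x + y, by ring⟩
  rw [add_sub_cancel] at hxy ⊢
  set U : Set ℂ := {z | z ∉ L.lattice ∧ c - z ∉ L.lattice} with hU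
  have hUc : (Uᶜ).Countable := by
    have h1 := L.countable_lattice.image (fun z => c - z)
    refine (L.countable_lattice.union h1).mono fun z hz => ?_
    simp only [hU, Set.mem_compl_iff, Set.mem_ofPred_eq, not_and_or, not_not] at hz
    rcases hz with h | h
    · exact Or.inl h
    · exact Or.inr ⟨c - z, h, by ring⟩
  have hUconn : IsConnected U := by
    have := hUc.isConnected_compl_of_one_lt_rank (E := ℂ) (by simp)
    rwa [compl_compl] at this
  have hUo : IsOpen U := L.isOpen_compl_lattice.inter
    (L.isOpen_compl_lattice.preimage (continuous_const.sub continuous_id))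
  have hcsub : ContinuousAt (fun z => c - z) 0 := by fun_prop
  have hU0 : ∀ᶠ z in 𝓝[≠] (0 : ℂ), z ∈ U := by
    have hev : ∀ᶠ z in 𝓝 (0 : ℂ), c - z ∉ L.lattice :=
      hcsub.preimage_mem_nhds (L.isOpen_compl_lattice.mem_nhds (by simpa using hxy))
    filter_upwards [L.eventually_notMem_lattice, mem_nhdsWithin_of_mem_nhds hev] with z h1 h2
    exact ⟨h1, h2⟩
  have hg : ContinuousAt (fun z => L.weierstrassP (c - z)) 0 :=
    ContinuousAt.comp (g := L.weierstrassP)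
      (by simpa using (L.hasDerivAt_weierstrassP hxy).continuousAt) hcsub
  obtain ⟨z₀, hz₀, hz₀ne⟩ := L.exists_weierstrassP_ne hg hU0
  have hfan : AnalyticOnNhd ℂ (fun z => L.weierstrassP z - L.weierstrassP (c - z)) U := by
    refine DifferentiableOn.analyticOnNhd (fun z hz => ?_) hUo
    exact ((L.hasDerivAt_weierstrassP hz.1).sub
      ((L.hasDerivAt_weierstrassP hz.2).comp_const_sub c z)).differentiableAt.differentiableWithinAt
  have hZ := hfan.countable_zeros hUconn hz₀ hz₀ne
  set V : Set ℂ := {z ∈ U | L.weierstrassP z - L.weierstrassP (c - z) ≠ 0} with hV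
  have hVo : IsOpen V := hfan.continuousOn.isOpen_inter_preimage hUo isOpen_compl_singleton
  have hVconn : IsConnected V := by
    have h := (hUc.union hZ).isConnected_compl_of_one_lt_rank (E := ℂ) (by simp)
    convert h using 1
    ext z
    simp only [hV, Set.mem_ofPred_eq, Set.mem_compl_iff, Set.mem_union, not_or, not_and, not_not]
    tauto
  set K : ℂ → ℂ := fun z =>
    L.addQuotient z (c - z) + L.weierstrassZeta z + L.weierstrassZeta (c - z) with hK
  have hKd : ∀ z ∈ V, HasDerivAt K 0 z := by
    intro z hz
    have := ((L.hasDerivAt_addQuotient hz.1.1 hz.1.2 (sub_ne_zero.mp hz.2)).add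
      (L.hasDerivAt_weierstrassZeta hz.1.1)).add
      ((L.hasDerivAt_weierstrassZeta hz.1.2).comp_const_sub c z)
    refine this.congr_deriv ?_
    ring
  have hxV : x ∈ V := ⟨⟨hx, hy⟩, sub_ne_zero.mpr hne⟩
  have hconst : ∀ z ∈ V, K z = K x := fun z hz =>
    hVo.is_const_of_deriv_eq_zero hVconn.isPreconnected
      (fun w hw => (hKd w hw).differentiableAt.differentiableWithinAt)
      (fun w hw => (hKd w hw).deriv) hz hxV
  -- the constant is found by letting `z` tend to `0`
  have hlim : Tendsto K (𝓝[≠] 0) (𝓝 (L.weierstrassZeta c)) := by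
    have hζ : ContinuousAt (fun z => L.weierstrassZeta (c - z)) 0 :=
      ContinuousAt.comp (g := L.weierstrassZeta)
        (by simpa using (L.hasDerivAt_weierstrassZeta hxy).continuousAt) hcsub
    have h := ((L.tendsto_addQuotient hxy).add L.tendsto_weierstrassZeta_sub_inv).add
      (hζ.tendsto.mono_left (nhdsWithin_le_nhds (s := {0}ᶜ)))
    simp only [add_zero, zero_add, sub_zero] at h
    refine h.congr fun z => ?_
    rw [hK]; ring
  have hV0 : ∀ᶠ z in 𝓝[≠] (0 : ℂ), z ∈ V := by
    have h := (L.tendsto_sq_mul_weierstrassP.sub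
      (((continuousAt_id.pow 2).mul hg).tendsto.mono_left (nhdsWithin_le_nhds (s := {0}ᶜ))))
    have h1 : (1 : ℂ) - (id 0 : ℂ) ^ 2 * L.weierstrassP (c - 0) ≠ 0 := by simp
    filter_upwards [hU0, h.eventually_ne h1] with z hz hz1
    refine ⟨hz, fun h0 => hz1 ?_⟩
    change z ^ 2 * L.weierstrassP z - z ^ 2 * L.weierstrassP (c - z) = 0
    linear_combination z ^ 2 * h0
  have := tendsto_nhds_unique hlim
    (tendsto_const_nhds.congr' (hV0.mono fun z hz => (hconst z hz).symm))
  rw [this, hK]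
  ring

end PeriodPair

/-! ### Uniqueness and quadrature for real differential equations -/

/-- Two solutions of an autonomous differential equation with `C¹` right hand side that agree at
one instant agree always. -/
lemma eq_of_hasDerivAt_of_contDiff {E : Type*} [NormedAddCommGroup E] [NormedSpace ℝ E]
    {v : E → E} (hv : ContDiff ℝ 1 v) {f g : ℝ → E} (hf : ∀ t, HasDerivAt f (v (f t)) t)
    (hg : ∀ t, HasDerivAt g (v (g t)) t) {t₀ : ℝ} (h : f t₀ = g t₀) : f = g := by
  funext t
  obtain ⟨a, b, ht, ht₀⟩ : ∃ a b, t ∈ Set.Ioo a b ∧ t₀ ∈ Set.Ioo a b := by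
    use (min t t₀ - 1), (max t t₀ + 1)
    grind
  have hfc : Continuous f := continuous_iff_continuousAt.mpr fun t => (hf t).continuousAt
  have hgc : Continuous g := continuous_iff_continuousAt.mpr fun t => (hg t).continuousAt
  have hS : IsCompact (f '' Set.Icc a b ∪ g '' Set.Icc a b) :=
    (isCompact_Icc.image hfc).union (isCompact_Icc.image hgc)
  obtain ⟨K, hK⟩ := (hv.locallyLipschitz.locallyLipschitzOn
    (s := f '' Set.Icc a b ∪ g '' Set.Icc a b)).exists_lipschitzOnWith_of_compact hS
  exact ODE_solution_unique_of_mem_Ioo (v := fun _ => v)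
    (s := fun _ => f '' Set.Icc a b ∪ g '' Set.Icc a b) (fun _ _ => hK) ht₀
    (fun t ht => ⟨hf t, Or.inl ⟨t, Set.Ioo_subset_Icc_self ht, rfl⟩⟩)
    (fun t ht => ⟨hg t, Or.inr ⟨t, Set.Ioo_subset_Icc_self ht, rfl⟩⟩) h ht

/-- If `f` comes down from infinity at `0`, satisfies `f' ^ 2 = R (f)`, and `R` is positive beyond
`c`, then `f` reaches `c` at the time `∫_c^∞ dv / √R`. -/
lemma eq_of_integral_inv_sqrt_eq {f f' R : ℝ → ℝ} {T c : ℝ} (hT : 0 < T)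
    (hd : ∀ x ∈ Set.Ioc 0 T, HasDerivAt f (f' x) x)
    (hsq : ∀ x ∈ Set.Ioc 0 T, f' x ^ 2 = R (f x))
    (htop : Filter.Tendsto f (𝓝[>] 0) Filter.atTop) (hR : ∀ v, c < v → 0 < R v)
    (hfT : f T ≤ c) (hint : ∫ v in Set.Ioi c, 1 / √(R v) = T) : f T = c := by
  have hcont : ContinuousOn f (Set.Ioc 0 T) := fun x hx =>
    (hd x hx).continuousAt.continuousWithinAt
  have hbig : ∀ v, ∃ ε > 0, ∀ x ∈ Set.Ioo 0 ε, v < f x := by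
    intro v
    obtain ⟨ε, hε, h⟩ := (mem_nhdsGT_iff_exists_Ioo_subset).mp (htop.eventually_gt_atTop v)
    exact ⟨ε, hε, fun x hx => h hx⟩
  obtain ⟨ε, hε, hεc⟩ := hbig c
  have hεT : ε ≤ T := by
    by_contra! h
    exact absurd (hεc T ⟨hT, h⟩) (not_lt.mpr hfT)
  have hIcc : ∀ x, 0 < x → ∀ y ≤ T, Set.Icc x y ⊆ Set.Ioc 0 T := fun x hx y hy z hz =>
    ⟨hx.trans_le hz.1, hz.2.trans hy⟩
  -- `X` is the first time at which the value `c` is taken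
  have hSc : IsCompact (Set.Icc (ε / 2) T ∩ f ⁻¹' {c}) :=
    isCompact_Icc.of_isClosed_subset
      ((hcont.mono (hIcc _ (by linarith) _ le_rfl)).preimage_isClosed_of_isClosed
        isClosed_Icc isClosed_singleton) Set.inter_subset_left
  have hex : ∀ y ∈ Set.Icc (ε / 2) T, f y ≤ c →
      ∃ z ∈ Set.Icc (ε / 2) T ∩ f ⁻¹' {c}, z ≤ y := by
    intro y hy hfy
    have h1 : c < f (ε / 2) := hεc _ ⟨by linarith, by linarith⟩
    obtain ⟨z, hz, hzc⟩ := intermediate_value_Icc' hy.1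
      (hcont.mono (hIcc _ (by linarith) _ hy.2)) ⟨hfy, h1.le⟩
    exact ⟨z, ⟨⟨hz.1, hz.2.trans hy.2⟩, hzc⟩, hz.2⟩
  obtain ⟨z₀, hz₀, -⟩ := hex T ⟨by linarith, le_rfl⟩ hfT
  obtain ⟨X, ⟨⟨hX1, hXT⟩, hXc⟩, hXmin⟩ := hSc.exists_isLeast ⟨z₀, hz₀⟩
  have hXc : f X = c := hXc
  have hX0 : 0 < X := by linarith
  have hgt : ∀ x ∈ Set.Ioo 0 X, c < f x := by
    intro x hx
    by_contra! h
    have hxε : ε / 2 ≤ x := by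
      by_contra! h'
      exact absurd (hεc x ⟨hx.1, by linarith⟩) (not_lt.mpr h)
    obtain ⟨z, hz, hzx⟩ := hex x ⟨hxε, hx.2.le.trans hXT⟩ h
    exact absurd (hXmin hz) (not_le.mpr (hzx.trans_lt hx.2))
  have hsub : Set.Ioo 0 X ⊆ Set.Ioc 0 T := fun x hx => ⟨hx.1, hx.2.le.trans hXT⟩
  have hne : ∀ x ∈ Set.Ioo 0 X, f' x ≠ 0 := by
    intro x hx h0
    have := hsq x (hsub hx)
    have h1 := hR _ (hgt x hx)
    rw [h0] at this
    simp [← this] at h1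
  have hlt_inj : ∀ x ∈ Set.Ioo 0 X, ∀ y ∈ Set.Ioo 0 X, x < y → f x ≠ f y := by
    intro x hx y hy hxy hfe
    obtain ⟨z, hz, hz0⟩ := exists_hasDerivAt_eq_zero hxy
      (hcont.mono (hIcc x hx.1 y (hy.2.le.trans hXT))) hfe
      (fun z hz => hd z ⟨hx.1.trans hz.1, (hz.2.trans hy.2).le.trans hXT⟩)
    exact hne z ⟨hx.1.trans hz.1, hz.2.trans hy.2⟩ hz0
  have hinj : Set.InjOn f (Set.Ioo 0 X) := by
    intro x hx y hy hfe
    rcases lt_trichotomy x y with h | h | h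
    · exact absurd hfe (hlt_inj x hx y hy h)
    · exact h
    · exact absurd hfe.symm (hlt_inj y hy x hx h)
  have himg : f '' Set.Ioo 0 X = Set.Ioi c := by
    ext v
    constructor
    · rintro ⟨x, hx, rfl⟩
      exact hgt x hx
    · intro hv
      obtain ⟨δ, hδ, hδv⟩ := hbig v
      set x := min (δ / 2) (X / 2) with hx
      have hx0 : 0 < x := by rw [hx]; positivity
      have hxX : x ≤ X / 2 := min_le_right _ _
      have hxδ : x ≤ δ / 2 := min_le_left _ _
      have hvx : v < f x := hδv x ⟨hx0, by linarith⟩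
      obtain ⟨z, hz, hzv⟩ := intermediate_value_Icc' (by linarith : x ≤ X)
        (hcont.mono (hIcc x hx0 X hXT)) ⟨by rw [hXc]; exact le_of_lt hv, hvx.le⟩
      refine ⟨z, ⟨hx0.trans_le hz.1, lt_of_le_of_ne hz.2 ?_⟩, hzv⟩
      rintro rfl
      rw [hXc] at hzv
      exact absurd hv (by rw [hzv]; simp)
  have hX : ∫ v in Set.Ioi c, 1 / √(R v) = X := by
    rw [← himg, MeasureTheory.integral_image_eq_integral_abs_deriv_smul measurableSet_Ioo
      (fun x hx => (hd x (hsub hx)).hasDerivWithinAt) hinj]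
    have : ∀ x ∈ Set.Ioo 0 X, |f' x| • (1 / √(R (f x))) = (1 : ℝ) := by
      intro x hx
      rw [← hsq x (hsub hx), Real.sqrt_sq_eq_abs, smul_eq_mul, mul_one_div_cancel]
      exact abs_ne_zero.mpr (hne x hx)
    rw [MeasureTheory.setIntegral_congr_fun measurableSet_Ioo this]
    simp [hX0.le]
  rw [← hint, hX, hXc]

/-! ### The uniformization of the curve `w² = R(u)` -/

namespace PeriodPair

open Filter ComplexConjugate

variable {L : PeriodPair}

lemma conj_mem_lattice (h₁ : conj L.ω₁ = -L.ω₁) (h₂ : conj L.ω₂ = L.ω₂) {z : ℂ}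
    (hz : z ∈ L.lattice) : conj z ∈ L.lattice := by
  obtain ⟨m, n, rfl⟩ := mem_lattice.mp hz
  refine mem_lattice.mpr ⟨-m, n, ?_⟩
  simp [h₁, h₂]

/-- On a rectangular lattice `℘` commutes with complex conjugation. -/
lemma weierstrassP_conj (h₁ : conj L.ω₁ = -L.ω₁) (h₂ : conj L.ω₂ = L.ω₂) (z : ℂ) :
    L.weierstrassP (conj z) = conj (L.weierstrassP z) := by
  let e : L.lattice ≃ L.lattice :=
    { toFun := fun l => ⟨conj (l : ℂ), conj_mem_lattice h₁ h₂ l.2⟩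
      invFun := fun l => ⟨conj (l : ℂ), conj_mem_lattice h₁ h₂ l.2⟩
      left_inv := fun l => by simp
      right_inv := fun l => by simp }
  simp only [weierstrassP]
  rw [Complex.conj_tsum, ← e.tsum_eq]
  refine tsum_congr fun l => ?_
  simp [e]

lemma derivWeierstrassP_conj (h₁ : conj L.ω₁ = -L.ω₁) (h₂ : conj L.ω₂ = L.ω₂) (z : ℂ) :
    L.derivWeierstrassP (conj z) = conj (L.derivWeierstrassP z) := by
  let e : L.lattice ≃ L.lattice :=
    { toFun := fun l => ⟨conj (l : ℂ), conj_mem_lattice h₁ h₂ l.2⟩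
      invFun := fun l => ⟨conj (l : ℂ), conj_mem_lattice h₁ h₂ l.2⟩
      left_inv := fun l => by simp
      right_inv := fun l => by simp }
  simp only [derivWeierstrassP]
  rw [map_neg, Complex.conj_tsum, ← e.tsum_eq]
  congr 1
  refine tsum_congr fun l => ?_
  simp [e, Complex.conj_ofNat]

end PeriodPair

namespace ToyTop

open ComplexConjugate Filter

/-- Half of the derivative of `R`, as a function of a complex variable. -/
def halfDerivR (e₁ e₂ e₃ : ℝ) (u : ℂ) : ℂ :=
  2 * ((u - e₁) * (u - e₂) + (u - e₁) * (u + e₃) + (u - e₂) * (u + e₃))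

/-- The invariants of the lattice are those of the curve `w² = R(u)`. -/
structure HasInvariants (e₁ e₂ e₃ : ℝ) (L : PeriodPair) : Prop where
  curve : ∀ z ∉ L.lattice, L.derivWeierstrassP z ^ 2 =
    4 * (L.weierstrassP z + ((1 / 3 * (e₁ + e₂ - e₃) : ℝ) : ℂ) - e₁) *
      (L.weierstrassP z + ((1 / 3 * (e₁ + e₂ - e₃) : ℝ) : ℂ) - e₂) *
      (L.weierstrassP z + ((1 / 3 * (e₁ + e₂ - e₃) : ℝ) : ℂ) + e₃)
  deriv_w : ∀ z ∉ L.lattice, 6 * L.weierstrassP z ^ 2 - L.g₂ / 2 =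
    halfDerivR e₁ e₂ e₃ (L.weierstrassP z + ((1 / 3 * (e₁ + e₂ - e₃) : ℝ) : ℂ))

/-- Two points of the plane lying over points of the curve with different `u` determine the
invariants: `4 ℘³ - g₂ ℘ - g₃` and `R` are cubic polynomials in `u` whose difference is linear. -/
lemma hasInvariants_of_liesOver {e₁ e₂ e₃ : ℝ} {L : PeriodPair} {a b : ℂ} {u₁ w₁ u₂ w₂ : ℝ}
    (ha : LiesOver e₁ e₂ e₃ L a u₁ w₁) (hb : LiesOver e₁ e₂ e₃ L b u₂ w₂) (hne : u₁ ≠ u₂)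
    (h₁ : w₁ ^ 2 = R e₁ e₂ e₃ u₁) (h₂ : w₂ ^ 2 = R e₁ e₂ e₃ u₂) :
    HasInvariants e₁ e₂ e₃ L := by
  set c : ℂ := ((1 / 3 * (e₁ + e₂ - e₃) : ℝ) : ℂ) with hc
  have hc3 : 3 * c = e₁ + e₂ - e₃ := by rw [hc]; push_cast; ring
  have hne' : (u₁ : ℂ) - u₂ ≠ 0 := sub_ne_zero.mpr (by exact_mod_cast hne)
  have point : ∀ {x : ℂ} {u w : ℝ}, LiesOver e₁ e₂ e₃ L x u w → w ^ 2 = R e₁ e₂ e₃ u →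
      4 * ((u : ℂ) - e₁) * (u - e₂) * (u + e₃) = 4 * (u - c) ^ 3 - L.g₂ * (u - c) - L.g₃ := by
    intro x u w h hw
    have hP : L.weierstrassP (x - halfPeriod L) = u - c := by
      rw [← h.u_eq, uFun]; ring
    have hw' := L.derivWeierstrassP_sq _ h.not_pole
    have h2 : L.derivWeierstrassP (x - halfPeriod L) = w := h.w_eq
    rw [hP, h2] at hw'
    rw [← hw']
    have := congrArg (fun r : ℝ => (r : ℂ)) hw
    simp only [R] at this
    push_cast at this
    exact this.symm
  have p₁ := point ha h₁
  have p₂ := point hb h₂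
  have hg2 : L.g₂ = -4 * ((e₁ - c) * (e₂ - c) + (e₁ - c) * (-e₃ - c) + (e₂ - c) * (-e₃ - c)) := by
    apply mul_left_cancel₀ hne'
    linear_combination p₁ - p₂ - (4 * ((u₁ : ℂ) ^ 2 - u₂ ^ 2) - 8 * c * ((u₁ : ℂ) - u₂)) * hc3
  have hg3 : L.g₃ = 4 * ((e₁ - c) * (e₂ - c) * (-e₃ - c)) := by
    rw [hg2] at p₁
    linear_combination p₁ - 4 * ((u₁ : ℂ) - c) ^ 2 * hc3
  constructor
  · intro z hz
    rw [L.derivWeierstrassP_sq z hz, hg2, hg3]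
    linear_combination (-4 * L.weierstrassP z ^ 2) * hc3
  · intro z hz
    rw [hg2, halfDerivR]
    linear_combination (-4 * L.weierstrassP z) * hc3

section Periods

variable {e₁ e₂ e₃ : ℝ} {L : PeriodPair}

lemma IsPeriodPair.exists_real (hL : IsPeriodPair e₁ e₂ e₃ L) :
    ∃ p q : ℝ, 0 < q ∧ q = ∫ u in Set.Ioi e₂, 1 / √(R e₁ e₂ e₃ u) ∧
      L.ω₁ = p * Complex.I ∧ L.ω₂ = 2 * q := by
  refine ⟨-(2 * ∫ u in e₁..e₂, 1 / √(-R e₁ e₂ e₃ u)),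
    ∫ u in Set.Ioi e₂, 1 / √(R e₁ e₂ e₃ u), ?_, rfl, ?_, hL.period₂⟩
  · refine lt_of_le_of_ne (MeasureTheory.integral_nonneg fun u => by positivity) fun h => ?_
    have h2 := hL.period₂
    rw [← h] at h2
    refine L.ω₂_div_two_notMem_lattice ?_
    rw [h2]
    simp
  · rw [hL.period₁]
    push_cast
    ring

lemma IsPeriodPair.re_eq_of_mem_lattice (hL : IsPeriodPair e₁ e₂ e₃ L) {z : ℂ}
    (hz : z ∈ L.lattice) : ∃ n : ℤ, z.re = 2 * n * (halfPeriod L).re := by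
  obtain ⟨p, q, -, -, h₁, h₂⟩ := hL.exists_real
  obtain ⟨m, n, rfl⟩ := PeriodPair.mem_lattice.mp hz
  refine ⟨n, ?_⟩
  rw [halfPeriod, h₁, h₂]
  simp
  ring

lemma IsPeriodPair.halfPeriod_eq (hL : IsPeriodPair e₁ e₂ e₃ L) :
    0 < (halfPeriod L).re ∧ halfPeriod L = (halfPeriod L).re ∧
      (halfPeriod L).re = ∫ u in Set.Ioi e₂, 1 / √(R e₁ e₂ e₃ u) := by
  obtain ⟨p, q, hq, hq', -, h₂⟩ := hL.exists_real
  have : halfPeriod L = q := by rw [halfPeriod, h₂]; ring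
  rw [this, Complex.ofReal_re]
  exact ⟨hq, rfl, hq'⟩

/-- The functions `u`, `w` have no poles on the imaginary axis. -/
lemma IsPeriodPair.sub_halfPeriod_notMem (hL : IsPeriodPair e₁ e₂ e₃ L) (y : ℝ) :
    (y * Complex.I - halfPeriod L) ∉ L.lattice := by
  intro h
  obtain ⟨n, hn⟩ := hL.re_eq_of_mem_lattice h
  have hq := hL.halfPeriod_eq.1
  have h1 : ((2 * n + 1 : ℤ) : ℝ) * (halfPeriod L).re = 0 := by
    simp at hn
    push_cast
    linarith
  rcases mul_eq_zero.mp h1 with h2 | h2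
  · have : (2 * n + 1 : ℤ) = 0 := by exact_mod_cast h2
    omega
  · exact hq.ne' h2

lemma IsPeriodPair.ofReal_notMem (hL : IsPeriodPair e₁ e₂ e₃ L) {x : ℝ} (hx : 0 < x)
    (hx' : x ≤ (halfPeriod L).re) : (x : ℂ) ∉ L.lattice := by
  intro h
  obtain ⟨n, hn⟩ := hL.re_eq_of_mem_lattice h
  have hq := hL.halfPeriod_eq.1
  rw [Complex.ofReal_re] at hn
  have h0 : 0 < n := by
    by_contra! h
    have : (n : ℝ) ≤ 0 := by exact_mod_cast h
    nlinarith
  have h1 : (1 : ℝ) ≤ n := by exact_mod_cast h0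
  nlinarith

/-- `w` vanishes at `x = 0`. -/
lemma wFun_zero (L : PeriodPair) : wFun L 0 = 0 := by
  have h : L.derivWeierstrassP (halfPeriod L) = -L.derivWeierstrassP (halfPeriod L) := by
    have h1 := L.derivWeierstrassP_add_coe (-halfPeriod L) ⟨L.ω₂, L.ω₂_mem_lattice⟩
    have h2 : -halfPeriod L + L.ω₂ = halfPeriod L := by rw [halfPeriod]; ring
    simp only [h2, L.derivWeierstrassP_neg] at h1
    exact h1
  rw [wFun, zero_sub, L.derivWeierstrassP_neg, CharZero.eq_neg_self_iff.mp h, neg_zero]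

/-- The point `x = 0` lies over the branch point `e₂`. -/
lemma uFun_zero (hL : IsPeriodPair e₁ e₂ e₃ L) (hinv : HasInvariants e₁ e₂ e₃ L)
    (h12 : e₁ < e₂) (h23 : -e₃ < e₂) : uFun e₁ e₂ e₃ L 0 = e₂ := by
  obtain ⟨p, q, hq, hq', h₁, h₂⟩ := hL.exists_real
  have hh : halfPeriod L = q := by rw [halfPeriod, h₂]; ring
  have hre : (halfPeriod L).re = q := by rw [hh]; simp
  set c : ℝ := 1 / 3 * (e₁ + e₂ - e₃) with hc
  have hc₁ : conj L.ω₁ = -L.ω₁ := by rw [h₁]; simp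
  have hc₂ : conj L.ω₂ = L.ω₂ := by rw [h₂]; simp [Complex.conj_ofNat]
  have hP : ∀ x : ℝ, L.weierstrassP x = ((L.weierstrassP x).re : ℂ) := by
    intro x
    have := PeriodPair.weierstrassP_conj hc₁ hc₂ (x : ℂ)
    rw [Complex.conj_ofReal] at this
    exact (Complex.conj_eq_iff_re.mp this.symm).symm
  have hP' : ∀ x : ℝ, L.derivWeierstrassP x = ((L.derivWeierstrassP x).re : ℂ) := by
    intro x
    have := PeriodPair.derivWeierstrassP_conj hc₁ hc₂ (x : ℂ)
    rw [Complex.conj_ofReal] at this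
    exact (Complex.conj_eq_iff_re.mp this.symm).symm
  have hd : ∀ x ∈ Set.Ioc 0 q, HasDerivAt (fun x : ℝ => (L.weierstrassP x).re + c)
      ((fun x : ℝ => (L.derivWeierstrassP x).re) x) x := by
    intro x hx
    exact ((L.hasDerivAt_weierstrassP
      (hL.ofReal_notMem hx.1 (by rw [hre]; exact hx.2))).real_of_complex).add_const c
  have hsq : ∀ x ∈ Set.Ioc 0 q, (fun x : ℝ => (L.derivWeierstrassP x).re) x ^ 2 =
      R e₁ e₂ e₃ ((fun x : ℝ => (L.weierstrassP x).re + c) x) := by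
    intro x hx
    have := hinv.curve x (hL.ofReal_notMem hx.1 (by rw [hre]; exact hx.2))
    rw [hP, hP'] at this
    simp only [R]
    exact_mod_cast this
  have htop : Tendsto (fun x : ℝ => (L.weierstrassP x).re + c) (𝓝[>] 0) atTop := by
    have hE : ContinuousAt (fun x : ℝ => (L.weierstrassPExcept 0 x).re + c) 0 := by
      have h1 : ContinuousAt (L.weierstrassPExcept 0) ((0 : ℝ) : ℂ) := by
        simpa using (L.analyticAt_weierstrassPExcept 0).continuousAt
      have h2 : ContinuousAt (fun x : ℝ => L.weierstrassPExcept 0 x) 0 :=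
        ContinuousAt.comp (f := fun x : ℝ => (x : ℂ)) h1 Complex.continuous_ofReal.continuousAt
      exact (Complex.continuous_re.continuousAt.comp h2).add continuousAt_const
    have h1 : Tendsto (fun x : ℝ => (x ^ 2)⁻¹) (𝓝[>] 0) atTop := by
      refine tendsto_inv_nhdsGT_zero.comp ?_
      rw [tendsto_nhdsWithin_iff]
      constructor
      · have : ContinuousAt (fun x : ℝ => x ^ 2) 0 := by fun_prop
        simpa using this.tendsto.mono_left (nhdsWithin_le_nhds (s := Set.Ioi 0))
      · filter_upwards [self_mem_nhdsWithin] with x hx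
        exact pow_pos (Set.mem_Ioi.mp hx) 2
    refine (h1.atTop_add (hE.tendsto.mono_left (nhdsWithin_le_nhds (s := Set.Ioi 0)))).congr ?_
    intro x
    rw [L.weierstrassP_eq_inv_sq_add x]
    have : (1 / (x : ℂ) ^ 2) = (((x ^ 2)⁻¹ : ℝ) : ℂ) := by push_cast; simp
    rw [Complex.add_re, this, Complex.ofReal_re]
    ring
  have hR : ∀ v, e₂ < v → 0 < R e₁ e₂ e₃ v := by
    intro v hv
    have h1 : 0 < v - e₁ := by linarith
    have h2 : 0 < v - e₂ := by linarith
    have h3 : 0 < v + e₃ := by linarith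
    unfold R
    positivity
  have hneg : L.weierstrassP (0 - halfPeriod L) = L.weierstrassP (q : ℂ) := by
    rw [zero_sub, L.weierstrassP_neg, hh]
  have hfT : (L.weierstrassP (q : ℂ)).re + c ≤ e₂ := by
    have h0 : L.derivWeierstrassP q = 0 := by
      have := wFun_zero L
      rw [wFun, zero_sub, L.derivWeierstrassP_neg, hh] at this
      exact neg_eq_zero.mp this
    have := hsq q ⟨hq, le_rfl⟩
    simp only [h0, Complex.zero_re, ne_eq, OfNat.ofNat_ne_zero, not_false_eq_true, zero_pow] at this
    by_contra! hlt
    exact (hR _ hlt).ne this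
  have := eq_of_integral_inv_sqrt_eq hq hd hsq htop hR hfT hq'.symm
  rw [uFun, hneg, hP]
  exact_mod_cast this

lemma uFun_hasDerivAt {x : ℂ} (hx : x - halfPeriod L ∉ L.lattice) :
    HasDerivAt (uFun e₁ e₂ e₃ L) (wFun L x) x :=
  ((L.hasDerivAt_weierstrassP hx).comp_sub_const x (halfPeriod L)).add_const _

lemma wFun_hasDerivAt (hinv : HasInvariants e₁ e₂ e₃ L) {x : ℂ}
    (hx : x - halfPeriod L ∉ L.lattice) :
    HasDerivAt (wFun L) (halfDerivR e₁ e₂ e₃ (uFun e₁ e₂ e₃ L x)) x := by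
  have := (L.hasDerivAt_derivWeierstrassP hx).comp_sub_const x (halfPeriod L)
  rw [hinv.deriv_w _ hx] at this
  exact this

/-- On the imaginary axis `x = i y` the function `u` is the solution of `d²u/dy² = -R'(u) / 2`
that starts at rest from `e₂`. -/
lemma uFun_imaginary (hL : IsPeriodPair e₁ e₂ e₃ L) (hinv : HasInvariants e₁ e₂ e₃ L)
    (h12 : e₁ < e₂) (h23 : -e₃ < e₂) {U V : ℝ → ℝ} (hU : ∀ y, HasDerivAt U (V y) y)
    (hV : ∀ y, HasDerivAt V (-(2 * ((U y - e₁) * (U y - e₂) + (U y - e₁) * (U y + e₃)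
      + (U y - e₂) * (U y + e₃)))) y) (hU0 : U 0 = e₂) (hV0 : V 0 = 0) (y : ℝ) :
    uFun e₁ e₂ e₃ L (y * Complex.I) = U y ∧ wFun L (y * Complex.I) * Complex.I = V y := by
  let F : ℂ × ℂ → ℂ × ℂ := fun p => (p.2, -halfDerivR e₁ e₂ e₃ p.1)
  have hF : ContDiff ℝ 1 F := by
    unfold F halfDerivR
    fun_prop
  have hline : ∀ y : ℝ, HasDerivAt (fun y : ℝ => (y : ℂ) * Complex.I) Complex.I y := by
    intro y
    simpa using (Complex.ofRealCLM.hasDerivAt (x := y)).mul_const Complex.I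
  have h1 : ∀ y : ℝ, HasDerivAt (fun y : ℝ => (uFun e₁ e₂ e₃ L (y * Complex.I),
      wFun L (y * Complex.I) * Complex.I))
      (F (uFun e₁ e₂ e₃ L (y * Complex.I), wFun L (y * Complex.I) * Complex.I)) y := by
    intro y
    have hy := hL.sub_halfPeriod_notMem y
    have hu := (uFun_hasDerivAt (e₁ := e₁) (e₂ := e₂) (e₃ := e₃) hy).comp_of_eq y (hline y) rfl
    have hw := ((wFun_hasDerivAt hinv hy).comp_of_eq y (hline y) rfl).mul_const Complex.I
    refine (hu.prodMk hw).congr_deriv (Prod.ext rfl ?_)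
    simp only [F]
    linear_combination (halfDerivR e₁ e₂ e₃ (uFun e₁ e₂ e₃ L (y * Complex.I))) * Complex.I_mul_I
  have h2 : ∀ y : ℝ, HasDerivAt (fun y : ℝ => ((U y : ℂ), (V y : ℂ)))
      (F ((U y : ℂ), (V y : ℂ))) y := by
    intro y
    refine ((hU y).ofReal_comp.prodMk (hV y).ofReal_comp).congr_deriv (Prod.ext rfl ?_)
    simp only [F, halfDerivR]
    push_cast
    ring
  have h := eq_of_hasDerivAt_of_contDiff hF h1 h2 (t₀ := 0) (by
    simp only [Complex.ofReal_zero, zero_mul, uFun_zero hL hinv h12 h23, wFun_zero, hU0, hV0])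
  have := congrFun h y
  exact ⟨congrArg Prod.fst this, congrArg Prod.snd this⟩

end Periods

end ToyTop

/-! ### The mechanics of the toy top in coordinates -/

namespace ToyTop

/-- The element of `su(2)` with coordinates `x, y, z`; the coordinates are chosen such that the
commutator becomes the cross product and `k` the third basis vector. -/
noncomputable def vec (x y z : ℝ) : Mat :=
  (Complex.I / 2) • !![(z : ℂ), x + y * Complex.I; x - y * Complex.I, -z]

lemma vec_mem_su2 (x y z : ℝ) : vec x y z ∈ su2 := by
  constructor
  · ext i j
    fin_cases i <;> fin_cases j <;>
      simp [vec, Matrix.conjTranspose_apply, Complex.ext_iff] <;>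
      first | ring1 | (constructor <;> ring1)
  · simp [vec, Matrix.trace_fin_two]

lemma exists_eq_vec {X : Mat} (hX : X ∈ su2) : ∃ x y z : ℝ, X = vec x y z := by
  obtain ⟨h, ht⟩ := hX
  have h00 := congrFun (congrFun h 0) 0
  have h01 := congrFun (congrFun h 0) 1
  have h11 := congrFun (congrFun h 1) 1
  simp [Matrix.conjTranspose_apply, Matrix.trace_fin_two, Complex.ext_iff] at h00 h01 h11 ht
  refine ⟨2 * (X 0 1).im, -(2 * (X 0 1).re), 2 * (X 0 0).im, ?_⟩
  ext i j
  fin_cases i <;> fin_cases j <;> simp [vec, Complex.ext_iff] <;>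
    first | linarith | (constructor <;> linarith)

lemma ip_vec (x y z x' y' z' : ℝ) :
    ip (vec x y z) (vec x' y' z') = x * x' + y * y' + z * z' := by
  simp [ip, vec, Matrix.trace_fin_two]
  ring

lemma br_vec (x y z x' y' z' : ℝ) :
    br (vec x y z) (vec x' y' z') =
      vec (y * z' - z * y') (z * x' - x * z') (x * y' - y * x') := by
  ext i j
  fin_cases i <;> fin_cases j <;>
    simp [br, vec, Complex.ext_iff] <;>
    first | ring1 | (constructor <;> ring1)

lemma k_eq_vec : k = vec 0 0 1 := by
  ext i j
  fin_cases i <;> fin_cases j <;> simp [k, vec, Complex.ext_iff]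

lemma vec_add (x y z x' y' z' : ℝ) :
    vec x y z + vec x' y' z' = vec (x + x') (y + y') (z + z') := by
  ext i j
  fin_cases i <;> fin_cases j <;> simp [vec, Complex.ext_iff] <;>
    first | ring1 | (constructor <;> ring1)

lemma smul_vec (a x y z : ℝ) : a • vec x y z = vec (a * x) (a * y) (a * z) := by
  ext i j
  fin_cases i <;> fin_cases j <;> simp [vec, Complex.ext_iff] <;>
    first | ring1 | (constructor <;> ring1)

/-- The derivative of the rotating axis `exp (ε η) r exp (-ε η)` is `[η, r]`, observed through a
linear functional. -/
lemma hasDerivAt_linear_axis (f : Mat →ₗ[ℝ] ℝ) (Φ η : Mat) :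
    HasDerivAt (fun ε : ℝ => f (axis (NormedSpace.exp (ε • η) * Φ))) (f (br η (axis Φ))) 0 := by
  let : NormedRing Mat := Matrix.linftyOpNormedRing
  let : NormedAlgebra ℝ Mat := Matrix.linftyOpNormedAlgebra
  have h1 : HasDerivAt (fun ε : ℝ => NormedSpace.exp (ε • η)) η 0 := by
    have h := hasDerivAt_exp_smul_const η (0 : ℝ)
    rw [zero_smul, NormedSpace.exp_zero, one_mul] at h
    exact h
  have h2 : HasDerivAt (fun ε : ℝ => NormedSpace.exp (ε • (-η))) (-η) 0 := by
    have h := hasDerivAt_exp_smul_const (-η) (0 : ℝ)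
    rw [zero_smul, NormedSpace.exp_zero, one_mul] at h
    exact h
  have h3 : HasDerivAt (fun ε : ℝ => NormedSpace.exp (ε • η) * axis Φ *
      NormedSpace.exp (ε • (-η))) (br η (axis Φ)) 0 := by
    refine ((h1.mul_const (axis Φ)).mul h2).congr_deriv ?_
    simp [br, sub_eq_add_neg]
  have h4 : ∀ ε : ℝ, axis (NormedSpace.exp (ε • η) * Φ) =
      NormedSpace.exp (ε • η) * axis Φ * NormedSpace.exp (ε • (-η)) := by
    intro ε
    rw [axis, Matrix.mul_inv_rev, smul_neg, Matrix.exp_neg, axis]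
    simp only [Matrix.mul_assoc]
  simp only [h4]
  exact (LinearMap.toContinuousLinearMap f).hasFDerivAt.comp_hasDerivAt (0 : ℝ) h3

lemma DL_eq (A C p s : ℝ) (Φ ω η : Mat) :
    DL A C p s Φ ω η = (C - A) * ip ω (axis Φ) * ip ω (br η (axis Φ))
      + p * s * ip (br (axis Φ) k) ω * ip (br (br η (axis Φ)) k) ω - p * ip (br η (axis Φ)) k := by
  let f₁ : Mat →ₗ[ℝ] ℝ :=
    { toFun := fun S => ip ω S
      map_add' := fun X Y => by simp [ip, mul_add]
      map_smul' := fun c X => by simp [ip]; ring }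
  let f₂ : Mat →ₗ[ℝ] ℝ :=
    { toFun := fun S => ip (br S k) ω
      map_add' := fun X Y => by
        simp [ip, br, Matrix.mul_add, Matrix.add_mul, Matrix.sub_mul]; ring
      map_smul' := fun c X => by simp [ip, br, Matrix.sub_mul]; ring }
  let f₃ : Mat →ₗ[ℝ] ℝ :=
    { toFun := fun S => ip S k
      map_add' := fun X Y => by simp [ip, Matrix.add_mul, mul_add]
      map_smul' := fun c X => by simp [ip]; ring }
  have h₁ := hasDerivAt_linear_axis f₁ Φ η
  have h₂ := hasDerivAt_linear_axis f₂ Φ η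
  have h₃ := hasDerivAt_linear_axis f₃ Φ η
  have h := ((((h₁.pow 2).const_mul (1 / 2 * (C - A))).const_add (1 / 2 * A * ip ω ω)).add
    ((h₂.pow 2).const_mul (1 / 2 * (p * s)))).sub (h₃.const_mul p)
  have h0 : axis (NormedSpace.exp ((0 : ℝ) • η) * Φ) = axis Φ := by simp
  rw [h0] at h
  rw [DL]
  have h' : HasDerivAt (fun ε : ℝ => lagrangian A C p s (NormedSpace.exp (ε • η) * Φ) ω) _ 0 := h
  rw [h'.deriv]
  simp only [f₁, f₂, f₃, LinearMap.coe_mk, AddHom.coe_mk]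
  ring

end ToyTop

/-! ### The first integrals and the nutation in coordinates -/

namespace ToyTop

/-- Curves in `ℝ³`: the axis `r` and the angular velocity `w` of the top, in coordinates. -/
structure Coords where
  (r₁ r₂ r₃ w₁ w₂ w₃ : ℝ → ℝ)

namespace Coords

/-- The component `⟨w, r⟩` of the angular velocity along the axis. -/
def spin (Q : Coords) (t : ℝ) : ℝ := Q.w₁ t * Q.r₁ t + Q.w₂ t * Q.r₂ t + Q.w₃ t * Q.r₃ t

/-- The velocity `⟨w, r × k⟩` of the height `r₃`. -/
def rate (Q : Coords) (t : ℝ) : ℝ := Q.w₁ t * Q.r₂ t - Q.w₂ t * Q.r₁ t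

/-- The first coordinate of the momentum. -/
def m₁ (Q : Coords) (A C p s t : ℝ) : ℝ :=
  A * Q.w₁ t + (C - A) * Q.spin t * Q.r₁ t + p * s * Q.rate t * Q.r₂ t

/-- The second coordinate of the momentum. -/
def m₂ (Q : Coords) (A C p s t : ℝ) : ℝ :=
  A * Q.w₂ t + (C - A) * Q.spin t * Q.r₂ t - p * s * Q.rate t * Q.r₁ t

/-- The third coordinate of the momentum. -/
def m₃ (Q : Coords) (A C t : ℝ) : ℝ :=
  A * Q.w₃ t + (C - A) * Q.spin t * Q.r₃ t

/-- The total energy. -/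
noncomputable def energy (Q : Coords) (A C p s t : ℝ) : ℝ :=
  1 / 2 * A * (Q.w₁ t ^ 2 + Q.w₂ t ^ 2 + Q.w₃ t ^ 2) + 1 / 2 * (C - A) * Q.spin t ^ 2
    + 1 / 2 * (p * s) * Q.rate t ^ 2 + p * Q.r₃ t

/-- The equations of motion in coordinates: `r' = w × r` and
`m' = w × m + (C - A) ⟨w, r⟩ r × w + p s r₃' r × (k × w) - p r × k`. -/
structure IsMotion (Q : Coords) (A C p s : ℝ) : Prop where
  unit : ∀ t, Q.r₁ t ^ 2 + Q.r₂ t ^ 2 + Q.r₃ t ^ 2 = 1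
  r₁ : ∀ t, HasDerivAt Q.r₁ (Q.w₂ t * Q.r₃ t - Q.w₃ t * Q.r₂ t) t
  r₂ : ∀ t, HasDerivAt Q.r₂ (Q.w₃ t * Q.r₁ t - Q.w₁ t * Q.r₃ t) t
  r₃ : ∀ t, HasDerivAt Q.r₃ (Q.rate t) t
  m₁ : ∀ t, HasDerivAt (Q.m₁ A C p s) (Q.w₂ t * Q.m₃ A C t - Q.w₃ t * Q.m₂ A C p s t
    + (C - A) * Q.spin t * (Q.r₂ t * Q.w₃ t - Q.r₃ t * Q.w₂ t)
    - p * s * Q.rate t * (Q.r₃ t * Q.w₁ t) - p * Q.r₂ t) t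
  m₂ : ∀ t, HasDerivAt (Q.m₂ A C p s) (Q.w₃ t * Q.m₁ A C p s t - Q.w₁ t * Q.m₃ A C t
    + (C - A) * Q.spin t * (Q.r₃ t * Q.w₁ t - Q.r₁ t * Q.w₃ t)
    - p * s * Q.rate t * (Q.r₃ t * Q.w₂ t) + p * Q.r₁ t) t
  m₃ : ∀ t, HasDerivAt (Q.m₃ A C) (Q.w₁ t * Q.m₂ A C p s t - Q.w₂ t * Q.m₁ A C p s t
    + (C - A) * Q.spin t * (Q.r₁ t * Q.w₂ t - Q.r₂ t * Q.w₁ t)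
    + p * s * Q.rate t * (Q.r₁ t * Q.w₁ t + Q.r₂ t * Q.w₂ t)) t

variable {Q : Coords} {A C p s : ℝ}

lemma eq_of_hasDerivAt_zero {f : ℝ → ℝ} (hf : ∀ t, HasDerivAt f 0 t) (t : ℝ) : f t = f 0 :=
  is_const_of_deriv_eq_zero (fun t => (hf t).differentiableAt) (fun t => (hf t).deriv) t 0

lemma IsMotion.m₃_const (h : Q.IsMotion A C p s) (t : ℝ) : Q.m₃ A C t = Q.m₃ A C 0 :=
  eq_of_hasDerivAt_zero (fun t => (h.m₃ t).congr_deriv (by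
    simp only [Coords.m₁, Coords.m₂, spin, rate]; ring)) t

lemma IsMotion.spin_const (h : Q.IsMotion A C p s) (hC : 0 < C) (t : ℝ) :
    Q.spin t = Q.spin 0 := by
  have hd : ∀ t, HasDerivAt (fun t => Q.m₁ A C p s t * Q.r₁ t + Q.m₂ A C p s t * Q.r₂ t
      + Q.m₃ A C t * Q.r₃ t) 0 t := fun t =>
    ((((h.m₁ t).mul (h.r₁ t)).add ((h.m₂ t).mul (h.r₂ t))).add
      ((h.m₃ t).mul (h.r₃ t))).congr_deriv (by simp only [spin, rate]; ring)
  have hn : ∀ t, Q.m₁ A C p s t * Q.r₁ t + Q.m₂ A C p s t * Q.r₂ t + Q.m₃ A C t * Q.r₃ t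
      = C * Q.spin t := by
    intro t
    simp only [Coords.m₁, Coords.m₂, Coords.m₃]
    have := h.unit t
    have hs : Q.spin t = Q.w₁ t * Q.r₁ t + Q.w₂ t * Q.r₂ t + Q.w₃ t * Q.r₃ t := rfl
    linear_combination (C - A) * Q.spin t * this - A * hs
  have := eq_of_hasDerivAt_zero hd t
  rw [hn, hn] at this
  exact mul_left_cancel₀ hC.ne' this

/-- The moment of inertia `A + p s (1 - u²)` of the nutation is positive. -/
lemma IsMotion.inertia_pos (h : Q.IsMotion A C p s) (hA : 0 < A) (hp : 0 < p) (hs : 0 < s)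
    (t : ℝ) : 0 < A + p * s * (1 - Q.r₃ t ^ 2) := by
  have : 0 ≤ 1 - Q.r₃ t ^ 2 := by
    have := h.unit t
    nlinarith [sq_nonneg (Q.r₁ t), sq_nonneg (Q.r₂ t)]
  positivity

/-- The acceleration of the height. -/
noncomputable def accel (Q : Coords) (A C p s t : ℝ) : ℝ :=
  (p * s * Q.r₃ t * Q.rate t ^ 2 + Q.w₃ t * (C * Q.spin t)
    - 2 * Q.r₃ t * (Q.energy A C p s t - p * Q.r₃ t) - p * (1 - Q.r₃ t ^ 2)) /
    (A + p * s * (1 - Q.r₃ t ^ 2))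

lemma IsMotion.rate_hasDerivAt (h : Q.IsMotion A C p s) (hA : 0 < A) (hp : 0 < p) (hs : 0 < s)
    (t : ℝ) : HasDerivAt Q.rate (Q.accel A C p s t) t := by
  have hpos := h.inertia_pos hA hp hs
  have hrate : Q.rate = fun t => (Q.m₁ A C p s t * Q.r₂ t - Q.m₂ A C p s t * Q.r₁ t) /
      (A + p * s * (1 - Q.r₃ t ^ 2)) := by
    funext t
    rw [eq_div_iff (hpos t).ne']
    simp only [Coords.m₁, Coords.m₂]
    have h1 : Q.rate t = Q.w₁ t * Q.r₂ t - Q.w₂ t * Q.r₁ t := rfl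
    linear_combination A * h1 - p * s * Q.rate t * h.unit t
  have hM := ((h.m₁ t).mul (h.r₂ t)).sub ((h.m₂ t).mul (h.r₁ t))
  have hD := ((((h.r₃ t).pow 2).const_sub 1).const_mul (p * s)).const_add A
  have hd : HasDerivAt (fun t => (Q.m₁ A C p s t * Q.r₂ t - Q.m₂ A C p s t * Q.r₁ t) /
      (A + p * s * (1 - Q.r₃ t ^ 2))) _ t := hM.div hD (hpos t).ne'
  rw [← hrate] at hd
  refine hd.congr_deriv ?_
  have hq : (Q.m₁ A C p s t * Q.r₂ t - Q.m₂ A C p s t * Q.r₁ t) =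
      Q.rate t * (A + p * s * (1 - Q.r₃ t ^ 2)) := by
    rw [congrFun hrate t, div_mul_cancel₀ _ (hpos t).ne']
  -- the torque along `r × k`
  have hMval : (Q.w₂ t * Q.m₃ A C t - Q.w₃ t * Q.m₂ A C p s t
      + (C - A) * Q.spin t * (Q.r₂ t * Q.w₃ t - Q.r₃ t * Q.w₂ t)
      - p * s * Q.rate t * (Q.r₃ t * Q.w₁ t) - p * Q.r₂ t) * Q.r₂ t
      + Q.m₁ A C p s t * (Q.w₃ t * Q.r₁ t - Q.w₁ t * Q.r₃ t)
      - ((Q.w₃ t * Q.m₁ A C p s t - Q.w₁ t * Q.m₃ A C t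
      + (C - A) * Q.spin t * (Q.r₃ t * Q.w₁ t - Q.r₁ t * Q.w₃ t)
      - p * s * Q.rate t * (Q.r₃ t * Q.w₂ t) + p * Q.r₁ t) * Q.r₁ t
      + Q.m₂ A C p s t * (Q.w₂ t * Q.r₃ t - Q.w₃ t * Q.r₂ t)) =
      -(p * s * Q.r₃ t * Q.rate t ^ 2) + Q.w₃ t * (C * Q.spin t)
        - 2 * Q.r₃ t * (Q.energy A C p s t - p * Q.r₃ t) - p * (1 - Q.r₃ t ^ 2) := by
    have hu := h.unit t
    simp only [Coords.m₁, Coords.m₂, Coords.m₃, energy]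
    have h1 : Q.rate t = Q.w₁ t * Q.r₂ t - Q.w₂ t * Q.r₁ t := rfl
    have h2 : Q.spin t = Q.w₁ t * Q.r₁ t + Q.w₂ t * Q.r₂ t + Q.w₃ t * Q.r₃ t := rfl
    rw [h1, h2]
    linear_combination (Q.w₃ t * (C - A) *
      (Q.w₁ t * Q.r₁ t + Q.w₂ t * Q.r₂ t + Q.w₃ t * Q.r₃ t) - p) * hu
  rw [accel, div_eq_div_iff (pow_ne_zero 2 (hpos t).ne') (hpos t).ne']
  simp only [Pi.sub_apply, Pi.mul_apply, hq, hMval]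
  push_cast
  ring

lemma IsMotion.energy_const (h : Q.IsMotion A C p s) (hA : 0 < A) (hC : 0 < C) (hp : 0 < p)
    (hs : 0 < s) (t : ℝ) : Q.energy A C p s t = Q.energy A C p s 0 := by
  -- `2 A h`, written in terms of the momentum, the constant spin, and the nutation
  have hE : ∀ t, 2 * A * Q.energy A C p s t = Q.m₁ A C p s t ^ 2 + Q.m₂ A C p s t ^ 2
      + Q.m₃ A C t ^ 2 - (C - A) * C * Q.spin 0 ^ 2
      - p * s * ((A + p * s * (1 - Q.r₃ t ^ 2)) * Q.rate t ^ 2) + 2 * A * p * Q.r₃ t := by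
    intro t
    rw [← h.spin_const hC t]
    simp only [Coords.m₁, Coords.m₂, Coords.m₃, energy]
    have hu := h.unit t
    have h1 : Q.rate t = Q.w₁ t * Q.r₂ t - Q.w₂ t * Q.r₁ t := rfl
    have h2 : Q.spin t = Q.w₁ t * Q.r₁ t + Q.w₂ t * Q.r₂ t + Q.w₃ t * Q.r₃ t := rfl
    rw [h1, h2]
    linear_combination (-(C - A) ^ 2 *
      (Q.w₁ t * Q.r₁ t + Q.w₂ t * Q.r₂ t + Q.w₃ t * Q.r₃ t) ^ 2
      - (p * s * (Q.w₁ t * Q.r₂ t - Q.w₂ t * Q.r₁ t)) ^ 2) * hu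
  have hd : ∀ t, HasDerivAt (fun t => Q.m₁ A C p s t ^ 2 + Q.m₂ A C p s t ^ 2
      + Q.m₃ A C t ^ 2 - (C - A) * C * Q.spin 0 ^ 2
      - p * s * ((A + p * s * (1 - Q.r₃ t ^ 2)) * Q.rate t ^ 2) + 2 * A * p * Q.r₃ t) 0 t := by
    intro t
    have hD := ((((h.r₃ t).pow 2).const_sub 1).const_mul (p * s)).const_add A
    have hacc : Q.accel A C p s t * (A + p * s * (1 - Q.r₃ t ^ 2)) = _ :=
      div_mul_cancel₀ _ (h.inertia_pos hA hp hs t).ne'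
    refine ((((((h.m₁ t).pow 2).add ((h.m₂ t).pow 2)).add ((h.m₃ t).pow 2)).sub_const _).sub
      ((hD.mul ((h.rate_hasDerivAt hA hp hs t).pow 2)).const_mul (p * s))).add
      ((h.r₃ t).const_mul (2 * A * p)) |>.congr_deriv ?_
    have hu := h.unit t
    have h1 : Q.rate t = Q.w₁ t * Q.r₂ t - Q.w₂ t * Q.r₁ t := rfl
    have h2 : Q.spin t = Q.w₁ t * Q.r₁ t + Q.w₂ t * Q.r₂ t + Q.w₃ t * Q.r₃ t := rfl
    simp only [Coords.m₁, Coords.m₂, Coords.m₃, energy, Pi.pow_apply] at hacc ⊢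
    rw [h1, h2] at hacc ⊢
    push_cast
    linear_combination (-2 * (p * s) * (Q.w₁ t * Q.r₂ t - Q.w₂ t * Q.r₁ t)) * hacc
      + 2 * (p * s) * (Q.w₁ t * Q.r₂ t - Q.w₂ t * Q.r₁ t) * ((C - A) *
        (Q.w₁ t * Q.r₁ t + Q.w₂ t * Q.r₂ t + Q.w₃ t * Q.r₃ t) * Q.w₃ t - p) * hu
  have := eq_of_hasDerivAt_zero hd t
  rw [← hE, ← hE] at this
  exact mul_left_cancel₀ (by positivity) this

end Coords

end ToyTop

namespace ToyTop

lemma hasDerivAt_cubic {A C p h l n : ℝ} (hp : p ≠ 0) (hA : A ≠ 0) (v : ℝ) :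
    HasDerivAt (cubic A C p h l n) (1 / p * (-2 * v * (h - n ^ 2 / (2 * C) - p * v)
      - p * (1 - v ^ 2) + n * (l - n * v) / A)) v := by
  have h1 : HasDerivAt (fun v : ℝ => 1 - v ^ 2) (-(2 * v)) v := by
    simpa using ((hasDerivAt_id v).pow 2).const_sub 1
  have h2 : HasDerivAt (fun v : ℝ => h - n ^ 2 / (2 * C) - p * v) (-p) v := by
    simpa using ((hasDerivAt_id v).const_mul p).const_sub (h - n ^ 2 / (2 * C))
  have h3 : HasDerivAt (fun v : ℝ => l - n * v) (-n) v := by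
    simpa using ((hasDerivAt_id v).const_mul n).const_sub l
  refine (((h1.const_mul (1 / p)).mul h2).sub
    ((h3.pow 2).const_mul (1 / (2 * A * p)))).congr_deriv ?_
  field_simp
  ring

namespace Coords

variable {Q : Coords} {A C p s : ℝ}

lemma IsMotion.abs_r₃_le (h : Q.IsMotion A C p s) (t : ℝ) : -1 ≤ Q.r₃ t ∧ Q.r₃ t ≤ 1 :=
  abs_le.mp <| (sq_le_one_iff_abs_le_one _).mp (by
    nlinarith [h.unit t, sq_nonneg (Q.r₁ t), sq_nonneg (Q.r₂ t)])

/-- The first-order equation of the nutation: up to the energy equation this is Gram's identity for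
the triple product `⟨w, r × k⟩`. -/
lemma IsMotion.cubic_r₃ (h : Q.IsMotion A C p s) (hA : A ≠ 0) (hp : p ≠ 0) (t : ℝ) :
    p * cubic A C p (Q.energy A C p s t) (Q.m₃ A C t) (C * Q.spin t) (Q.r₃ t) =
      1 / 2 * (A + p * s * (1 - Q.r₃ t ^ 2)) * Q.rate t ^ 2 := by
  have hu := h.unit t
  have h1 : Q.rate t = Q.w₁ t * Q.r₂ t - Q.w₂ t * Q.r₁ t := rfl
  have h2 : Q.spin t = Q.w₁ t * Q.r₁ t + Q.w₂ t * Q.r₂ t + Q.w₃ t * Q.r₃ t := rfl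
  have h3 : p * cubic A C p (Q.energy A C p s t) (Q.m₃ A C t) (C * Q.spin t) (Q.r₃ t) =
      (1 - Q.r₃ t ^ 2) * (1 / 2 * A * (Q.w₁ t ^ 2 + Q.w₂ t ^ 2 + Q.w₃ t ^ 2 - Q.spin t ^ 2)
        + 1 / 2 * (p * s) * Q.rate t ^ 2)
      - 1 / 2 * A * (Q.w₃ t - Q.spin t * Q.r₃ t) ^ 2 := by
    simp only [cubic, Coords.m₃, energy]
    field_simp
    ring
  rw [h3, h1, h2]
  linear_combination (-(1 / 2) * A * (Q.w₁ t ^ 2 + Q.w₂ t ^ 2)) * hu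

lemma IsMotion.accel_eq (h : Q.IsMotion A C p s) (hA : 0 < A) (hp : 0 < p) (hs : 0 < s)
    (t : ℝ) :
    (A + p * s * (1 - Q.r₃ t ^ 2)) * Q.accel A C p s t = p * s * Q.r₃ t * Q.rate t ^ 2 +
      p * deriv (cubic A C p (Q.energy A C p s t) (Q.m₃ A C t) (C * Q.spin t)) (Q.r₃ t) := by
  rw [accel, mul_div_cancel₀ _ (h.inertia_pos hA hp hs t).ne',
    (hasDerivAt_cubic hp.ne' hA.ne' _).deriv]
  simp only [Coords.m₃]
  field_simp
  ring

/-- At its lowest position the axis cannot accelerate downward. -/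
lemma IsMotion.accel_nonneg (h : Q.IsMotion A C p s) (hA : 0 < A) {t : ℝ} (ht : Q.r₃ t = -1) :
    0 ≤ Q.accel A C p s t := by
  have hu := h.unit t
  rw [ht] at hu
  have h1 : Q.r₁ t = 0 := by nlinarith [sq_nonneg (Q.r₁ t), sq_nonneg (Q.r₂ t)]
  have h2 : Q.r₂ t = 0 := by nlinarith [sq_nonneg (Q.r₁ t), sq_nonneg (Q.r₂ t)]
  have : Q.accel A C p s t = Q.w₁ t ^ 2 + Q.w₂ t ^ 2 := by
    have hA' := hA.ne'
    simp only [accel, energy, spin, rate, ht, h1, h2]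
    rw [div_eq_iff (by simpa using hA')]
    ring
  rw [this]
  positivity

end Coords

/-! ### Motions in `SU(2)` and their coordinates -/

section Motion

open ComplexConjugate

variable {A C p s : ℝ} {Φ ω : ℝ → Mat}

lemma entries_of_mem {Φ : Mat} (h : Φ ∈ Matrix.specialUnitaryGroup (Fin 2) ℂ) :
    Φ 1 1 = conj (Φ 0 0) ∧ Φ 0 1 = -conj (Φ 1 0) ∧ Φ⁻¹ = Φᴴ ∧
      Complex.normSq (Φ 0 0) + Complex.normSq (Φ 1 0) = 1 := by
  obtain ⟨hU, hdet⟩ := Matrix.mem_specialUnitaryGroup_iff.mp h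
  have hinv : Φ⁻¹ = Φᴴ := Matrix.inv_eq_right_inv (Matrix.mem_unitaryGroup_iff.mp hU)
  have hadj : Φ⁻¹ = !![Φ 1 1, -Φ 0 1; -Φ 1 0, Φ 0 0] := by
    rw [Matrix.inv_def, hdet, Ring.inverse_one, one_smul, Matrix.adjugate_fin_two]
  have h0 : Φ 1 1 = conj (Φ 0 0) := by
    have := congrFun (congrFun (hadj.symm.trans hinv) 0) 0
    simpa [Matrix.conjTranspose_apply] using this
  have h1 : Φ 0 1 = -conj (Φ 1 0) := by
    have := congrFun (congrFun (hadj.symm.trans hinv) 0) 1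
    rw [← neg_eq_iff_eq_neg]
    simpa [Matrix.conjTranspose_apply] using this
  refine ⟨h0, h1, hinv, ?_⟩
  rw [Matrix.det_fin_two, h0, h1, neg_mul, sub_neg_eq_add, Complex.mul_conj,
    mul_comm (conj _), Complex.mul_conj] at hdet
  exact_mod_cast hdet

lemma axis_eq_vec {Φ : Mat} (h : Φ ∈ Matrix.specialUnitaryGroup (Fin 2) ℂ) :
    axis Φ = vec (2 * ((Φ 0 0).re * (Φ 1 0).re + (Φ 0 0).im * (Φ 1 0).im))
      (2 * ((Φ 0 0).im * (Φ 1 0).re - (Φ 0 0).re * (Φ 1 0).im))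
      (Complex.normSq (Φ 0 0) - Complex.normSq (Φ 1 0)) := by
  obtain ⟨h0, h1, hinv, -⟩ := entries_of_mem h
  rw [axis, hinv]
  ext i j
  fin_cases i <;> fin_cases j <;>
    simp [k, vec, Matrix.mul_apply, Fin.sum_univ_two, Matrix.conjTranspose_apply, h0, h1,
      Complex.ext_iff, Complex.normSq_apply] <;>
    first | ring1 | (constructor <;> ring1)

lemma height_eq {Φ : Mat} (h : Φ ∈ Matrix.specialUnitaryGroup (Fin 2) ℂ) :
    height Φ = Complex.normSq (Φ 0 0) - Complex.normSq (Φ 1 0) := by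
  rw [height, axis_eq_vec h, k_eq_vec, ip_vec]
  ring

lemma IsMotion.angular_mem_su2 (hm : IsMotion A C p s Φ ω) (t : ℝ) : ω t ∈ su2 := by
  have hU : ∀ t, Φ t * (Φ t)ᴴ = 1 := fun t =>
    Matrix.mem_unitaryGroup_iff.mp (Matrix.mem_specialUnitaryGroup_iff.mp (hm.mem t)).1
  constructor
  · ext i j
    have hc : ∀ i j, HasDerivAt (fun t => star (Φ t i j)) (star ((ω t * Φ t) i j)) t :=
      fun i j => (hm.kinematic t i j).star
    have h1 := ((hm.kinematic t i 0).mul (hc j 0)).add ((hm.kinematic t i 1).mul (hc j 1))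
    have h2 : (fun t => Φ t i 0 * star (Φ t j 0) + Φ t i 1 * star (Φ t j 1)) =
        fun _ => (1 : Mat) i j := by
      funext t
      rw [← hU t, Matrix.mul_apply, Fin.sum_univ_two]
      rfl
    have h3 := h1.unique
      ((hasDerivAt_const t _).congr_of_eventuallyEq (Filter.EventuallyEq.of_eq h2))
    have h4 : (ω t * Φ t * (Φ t)ᴴ + Φ t * (ω t * Φ t)ᴴ) i j = 0 := by
      rw [← h3, Matrix.add_apply, Matrix.mul_apply, Matrix.mul_apply, Fin.sum_univ_two,
        Fin.sum_univ_two]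
      simp only [Matrix.conjTranspose_apply]
      ring
    rw [Matrix.conjTranspose_mul, Matrix.mul_assoc, hU, ← Matrix.mul_assoc, hU, mul_one, one_mul,
      Matrix.add_apply] at h4
    rw [Matrix.neg_apply]
    exact eq_neg_of_add_eq_zero_right h4
  · have h1 := ((hm.kinematic t 0 0).mul (hm.kinematic t 1 1)).sub
      ((hm.kinematic t 0 1).mul (hm.kinematic t 1 0))
    have hdet : ∀ t, Φ t 0 0 * Φ t 1 1 - Φ t 0 1 * Φ t 1 0 = 1 := fun t => by
      rw [← Matrix.det_fin_two, (Matrix.mem_specialUnitaryGroup_iff.mp (hm.mem t)).2]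
    have h2 : (fun t => Φ t 0 0 * Φ t 1 1 - Φ t 0 1 * Φ t 1 0) = fun _ => (1 : ℂ) := funext hdet
    have h3 := h1.unique
      ((hasDerivAt_const t _).congr_of_eventuallyEq (Filter.EventuallyEq.of_eq h2))
    simp only [Matrix.mul_apply, Fin.sum_univ_two] at h3
    rw [Matrix.trace_fin_two]
    linear_combination h3 - (ω t 0 0 + ω t 1 1) * hdet t

/-- The coordinates of a motion. -/
lemma IsMotion.exists_coords (hm : IsMotion A C p s Φ ω) : ∃ Q : Coords, Q.IsMotion A C p s ∧
    ∀ t, ω t = vec (Q.w₁ t) (Q.w₂ t) (Q.w₃ t) ∧ Q.r₃ t = height (Φ t) ∧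
      Q.r₁ t = 2 * ((Φ t 0 0).re * (Φ t 1 0).re + (Φ t 0 0).im * (Φ t 1 0).im) ∧
      Q.r₂ t = 2 * ((Φ t 0 0).im * (Φ t 1 0).re - (Φ t 0 0).re * (Φ t 1 0).im) ∧
      energy A C p s (Φ t) (ω t) = Q.energy A C p s t ∧
      integralL A C p s (Φ t) (ω t) = Q.m₃ A C t ∧
      integralN A C p s (Φ t) (ω t) = C * Q.spin t := by
  choose w₁ w₂ w₃ hw using fun t => exists_eq_vec (hm.angular_mem_su2 t)
  let Q : Coords :=
    { r₁ := fun t => 2 * ((Φ t 0 0).re * (Φ t 1 0).re + (Φ t 0 0).im * (Φ t 1 0).im)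
      r₂ := fun t => 2 * ((Φ t 0 0).im * (Φ t 1 0).re - (Φ t 0 0).re * (Φ t 1 0).im)
      r₃ := fun t => Complex.normSq (Φ t 0 0) - Complex.normSq (Φ t 1 0)
      w₁ := w₁, w₂ := w₂, w₃ := w₃ }
  have hax : ∀ t, axis (Φ t) = vec (Q.r₁ t) (Q.r₂ t) (Q.r₃ t) := fun t => axis_eq_vec (hm.mem t)
  have hω : ∀ t, ω t = vec (Q.w₁ t) (Q.w₂ t) (Q.w₃ t) := hw
  have hspin : ∀ t, ip (ω t) (axis (Φ t)) = Q.spin t := fun t => by rw [hω, hax, ip_vec]; rfl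
  have hq : ∀ t, br (axis (Φ t)) k = vec (Q.r₂ t) (-Q.r₁ t) 0 := fun t => by
    rw [hax, k_eq_vec, br_vec]; congr 1 <;> ring
  have hrate : ∀ t, ip (br (axis (Φ t)) k) (ω t) = Q.rate t := fun t => by
    rw [hq, hω, ip_vec, Coords.rate]; ring
  have hmom : ∀ t, momentum A C p s (Φ t) (ω t) =
      vec (Q.m₁ A C p s t) (Q.m₂ A C p s t) (Q.m₃ A C t) := fun t => by
    rw [momentum, hspin, hrate, hq, hω, hax, smul_vec, smul_vec, smul_vec, vec_add, vec_add]
    simp only [Coords.m₁, Coords.m₂, Coords.m₃]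
    congr 1 <;> ring
  have hun : ∀ t, Q.r₁ t ^ 2 + Q.r₂ t ^ 2 + Q.r₃ t ^ 2 = 1 := fun t => by
    have h := (entries_of_mem (hm.mem t)).2.2.2
    simp only [Q]
    rw [Complex.normSq_apply, Complex.normSq_apply] at *
    linear_combination ((Φ t 0 0).re * (Φ t 0 0).re + (Φ t 0 0).im * (Φ t 0 0).im
      + ((Φ t 1 0).re * (Φ t 1 0).re + (Φ t 1 0).im * (Φ t 1 0).im) + 1) * h
  have hre : ∀ t i j, HasDerivAt (fun t => (Φ t i j).re) ((ω t * Φ t) i j).re t := fun t i j =>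
    Complex.reCLM.hasFDerivAt.comp_hasDerivAt t (hm.kinematic t i j)
  have him : ∀ t i j, HasDerivAt (fun t => (Φ t i j).im) ((ω t * Φ t) i j).im t := fun t i j =>
    Complex.imCLM.hasFDerivAt.comp_hasDerivAt t (hm.kinematic t i j)
  have hL : ∀ t, integralL A C p s (Φ t) (ω t) = Q.m₃ A C t := fun t => by
    rw [integralL, hmom, k_eq_vec, ip_vec]; ring
  have hN : ∀ t, integralN A C p s (Φ t) (ω t) = C * Q.spin t := fun t => by
    rw [integralN, hmom, hax, ip_vec]
    simp only [Coords.m₁, Coords.m₂, Coords.m₃]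
    have hs : Q.spin t = Q.w₁ t * Q.r₁ t + Q.w₂ t * Q.r₂ t + Q.w₃ t * Q.r₃ t := rfl
    linear_combination (C - A) * Q.spin t * hun t - A * hs
  have hE : ∀ t, energy A C p s (Φ t) (ω t) = Q.energy A C p s t := fun t => by
    rw [energy, kinetic, potential, hspin, hrate, height, hax, k_eq_vec, ip_vec, hω, ip_vec,
      Coords.energy]
    ring
  have hdyn : ∀ t x y z, HasDerivAt (fun t => Q.m₁ A C p s t * x + Q.m₂ A C p s t * y
      + Q.m₃ A C t * z) ((Q.w₂ t * Q.m₃ A C t - Q.w₃ t * Q.m₂ A C p s t) * x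
      + (Q.w₃ t * Q.m₁ A C p s t - Q.w₁ t * Q.m₃ A C t) * y
      + (Q.w₁ t * Q.m₂ A C p s t - Q.w₂ t * Q.m₁ A C p s t) * z
      + (C - A) * Q.spin t * (Q.w₁ t * (y * Q.r₃ t - z * Q.r₂ t)
        + Q.w₂ t * (z * Q.r₁ t - x * Q.r₃ t) + Q.w₃ t * (x * Q.r₂ t - y * Q.r₁ t))
      + p * s * Q.rate t * ((z * Q.r₁ t - x * Q.r₃ t) * Q.w₁ t
        - (y * Q.r₃ t - z * Q.r₂ t) * Q.w₂ t) - p * (x * Q.r₂ t - y * Q.r₁ t)) t :=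
    fun t x y z => by
      have h := hm.dynamic t (vec x y z) (vec_mem_su2 x y z)
      simp only [hmom, ip_vec] at h
      rw [DL_eq, hspin, hrate, hω, hax, k_eq_vec, br_vec, br_vec, br_vec, ip_vec, ip_vec,
        ip_vec, ip_vec] at h
      exact h.congr_deriv (by ring)
  have hQ : Q.IsMotion A C p s :=
    { unit := hun
      r₁ := fun t => by
        refine ((((hre t 0 0).mul (hre t 1 0)).add ((him t 0 0).mul (him t 1 0))).const_mul
          2).congr_deriv ?_
        rw [hω]
        simp [vec, Matrix.mul_apply, Fin.sum_univ_two, Q, Complex.normSq_apply]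
        ring
      r₂ := fun t => by
        refine ((((him t 0 0).mul (hre t 1 0)).sub ((hre t 0 0).mul (him t 1 0))).const_mul
          2).congr_deriv ?_
        rw [hω]
        simp [vec, Matrix.mul_apply, Fin.sum_univ_two, Q, Complex.normSq_apply]
        ring
      r₃ := fun t => by
        have hd := (((hre t 0 0).mul (hre t 0 0)).add ((him t 0 0).mul (him t 0 0))).sub
          (((hre t 1 0).mul (hre t 1 0)).add ((him t 1 0).mul (him t 1 0)))
        have hr : Q.r₃ = fun t => (Φ t 0 0).re * (Φ t 0 0).re + (Φ t 0 0).im * (Φ t 0 0).im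
          - ((Φ t 1 0).re * (Φ t 1 0).re + (Φ t 1 0).im * (Φ t 1 0).im) := by
          funext t
          simp only [Q, Complex.normSq_apply]
        rw [hr]
        refine HasDerivAt.congr_deriv hd ?_
        rw [hω]
        simp [vec, Matrix.mul_apply, Fin.sum_univ_two, Q, Coords.rate]
        ring
      m₁ := fun t => by
        have h := hdyn t 1 0 0
        simp only [mul_one, mul_zero, add_zero, zero_mul] at h
        exact h.congr_deriv (by ring)
      m₂ := fun t => by
        have h := hdyn t 0 1 0
        simp only [mul_one, mul_zero, add_zero, zero_add, zero_mul] at h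
        exact h.congr_deriv (by ring)
      m₃ := fun t => by
        have h := hdyn t 0 0 1
        simp only [mul_one, mul_zero, add_zero, zero_add, zero_mul] at h
        exact h.congr_deriv (by ring) }
  exact ⟨Q, hQ, fun t => ⟨hω t, (height_eq (hm.mem t)).symm, rfl, rfl, hE t, hL t, hN t⟩⟩

end Motion

end ToyTop

/-! ### The differential equations of the Cayley-Klein parameters -/

namespace ToyTop

section CayleyKlein

open ComplexConjugate

variable {A C p s : ℝ} {Φ ω : ℝ → Mat}

lemma cayleyKlein_apply (A C n : ℝ) (Φ : ℝ → Mat) (t : ℝ) (i : Fin 2) :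
    cayleyKlein A C n Φ t i 0 =
      Φ t i 0 * Complex.exp (-(Complex.I / 2 * (((1 / C - 1 / A) * n * t : ℝ) : ℂ))) ∧
    cayleyKlein A C n Φ t i 1 =
      Φ t i 1 * Complex.exp (Complex.I / 2 * (((1 / C - 1 / A) * n * t : ℝ) : ℂ)) := by
  simp [cayleyKlein, Matrix.mul_apply, Fin.sum_univ_two]

lemma cayleyKlein_conj (A C n : ℝ) {Φ : ℝ → Mat}
    (h : ∀ t, Φ t ∈ Matrix.specialUnitaryGroup (Fin 2) ℂ) (t : ℝ) :
    cayleyKlein A C n Φ t 1 1 = conj (cayleyKlein A C n Φ t 0 0) ∧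
      cayleyKlein A C n Φ t 0 1 = -conj (cayleyKlein A C n Φ t 1 0) := by
  obtain ⟨h0, h1, -, -⟩ := entries_of_mem (h t)
  rw [(cayleyKlein_apply A C n Φ t 0).1, (cayleyKlein_apply A C n Φ t 0).2,
    (cayleyKlein_apply A C n Φ t 1).1, (cayleyKlein_apply A C n Φ t 1).2, h0, h1, map_mul, map_mul,
    ← Complex.exp_conj]
  simp [Complex.conj_ofNat]
  ring_nf
  simp

lemma normSq_cayleyKlein (A C n : ℝ) {Φ : ℝ → Mat}
    (h : ∀ t, Φ t ∈ Matrix.specialUnitaryGroup (Fin 2) ℂ) (t : ℝ) :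
    2 * Complex.normSq (cayleyKlein A C n Φ t 0 0) = 1 + height (Φ t) ∧
      2 * Complex.normSq (cayleyKlein A C n Φ t 1 0) = 1 - height (Φ t) := by
  have he : Complex.normSq
      (Complex.exp (-(Complex.I / 2 * (((1 / C - 1 / A) * n * t : ℝ) : ℂ)))) = 1 := by
    rw [Complex.normSq_eq_norm_sq, Complex.norm_exp]
    simp
  rw [(cayleyKlein_apply A C n Φ t 0).1, (cayleyKlein_apply A C n Φ t 1).1, Complex.normSq_mul,
    Complex.normSq_mul, he, height_eq (h t)]
  constructor <;> linarith [(entries_of_mem (h t)).2.2.2]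

/-- The equations that a motion with energy `h` and momentum integrals `l`, `n` implies for the
height of the axis, with velocity `u₁` and acceleration `u₂`, and for the Cayley-Klein parameters
`α` and `γ` seen from the rotating frame. -/
structure ReducedMotion (A C p s h l n : ℝ) (Φ : ℝ → Mat) (u₁ u₂ : ℝ → ℝ) : Prop where
  mem : ∀ t, Φ t ∈ Matrix.specialUnitaryGroup (Fin 2) ℂ
  height : ∀ t, HasDerivAt (fun t => height (Φ t)) (u₁ t) t
  velocity : ∀ t, HasDerivAt u₁ (u₂ t) t
  mem_Icc : ∀ t, -1 ≤ ToyTop.height (Φ t) ∧ ToyTop.height (Φ t) ≤ 1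
  first_order : ∀ t, p * cubic A C p h l n (ToyTop.height (Φ t)) =
    1 / 2 * (A + p * s * (1 - ToyTop.height (Φ t) ^ 2)) * u₁ t ^ 2
  second_order : ∀ t, (A + p * s * (1 - ToyTop.height (Φ t) ^ 2)) * u₂ t =
    p * s * ToyTop.height (Φ t) * u₁ t ^ 2
      + p * deriv (cubic A C p h l n) (ToyTop.height (Φ t))
  lowest : ∀ t, ToyTop.height (Φ t) = -1 → 0 ≤ u₂ t
  alpha : ∀ t, ∃ f', HasDerivAt (fun t => cayleyKlein A C n Φ t 0 0) f' t ∧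
    2 * (1 + ToyTop.height (Φ t)) * f' =
      (u₁ t + Complex.I * ((l + n) / A : ℝ)) * cayleyKlein A C n Φ t 0 0
  gamma : ∀ t, ∃ f', HasDerivAt (fun t => cayleyKlein A C n Φ t 1 0) f' t ∧
    2 * (1 - ToyTop.height (Φ t)) * f' =
      (-u₁ t - Complex.I * ((l - n) / A : ℝ)) * cayleyKlein A C n Φ t 1 0

lemma IsMotion.reduced (hA : 0 < A) (hC : 0 < C) (hp : 0 < p) (hs : 0 < s)
    (hm : IsMotion A C p s Φ ω) {h l n : ℝ} (hh : h = energy A C p s (Φ 0) (ω 0))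
    (hl : l = integralL A C p s (Φ 0) (ω 0)) (hn : n = integralN A C p s (Φ 0) (ω 0)) :
    ∃ u₁ u₂ : ℝ → ℝ, ReducedMotion A C p s h l n Φ u₁ u₂ := by
  obtain ⟨Q, hQ, hc⟩ := hm.exists_coords
  have hh' : ∀ t, Q.energy A C p s t = h := fun t => by
    rw [hh, (hc 0).2.2.2.2.1, hQ.energy_const hA hC hp hs]
  have hl' : ∀ t, Q.m₃ A C t = l := fun t => by rw [hl, (hc 0).2.2.2.2.2.1, hQ.m₃_const]
  have hn' : ∀ t, C * Q.spin t = n := fun t => by rw [hn, (hc 0).2.2.2.2.2.2, hQ.spin_const hC]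
  have hu : ∀ t, Q.r₃ t = height (Φ t) := fun t => (hc t).2.1
  have hexp : ∀ t : ℝ, HasDerivAt
      (fun t : ℝ => Complex.exp (-(Complex.I / 2 * (((1 / C - 1 / A) * n * t : ℝ) : ℂ))))
      (-(Complex.I / 2 * (((1 / C - 1 / A) * n : ℝ) : ℂ)) *
        Complex.exp (-(Complex.I / 2 * (((1 / C - 1 / A) * n * t : ℝ) : ℂ)))) t := by
    intro t
    have h1 : HasDerivAt (fun t : ℝ => (1 / C - 1 / A) * n * t) ((1 / C - 1 / A) * n) t := by
      simpa using (hasDerivAt_id t).const_mul ((1 / C - 1 / A) * n)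
    exact ((h1.ofReal_comp.const_mul (Complex.I / 2)).neg.cexp).congr_deriv (by
      rw [Pi.neg_apply, mul_comm])
  have hspin : ∀ t, ((Q.spin t : ℝ) : ℂ) =
      Q.w₁ t * Q.r₁ t + Q.w₂ t * Q.r₂ t + Q.w₃ t * Q.r₃ t := fun t => by
    simp only [Coords.spin]; push_cast; ring
  have hrate : ∀ t, ((Q.rate t : ℝ) : ℂ) = Q.w₁ t * Q.r₂ t - Q.w₂ t * Q.r₁ t := fun t => by
    simp only [Coords.rate]; push_cast; ring
  -- `2 α conj γ = r₁ + i r₂`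
  have hr : ∀ t, 2 * Φ t 0 0 * conj (Φ t 1 0) = Q.r₁ t + Q.r₂ t * Complex.I := fun t => by
    rw [(hc t).2.2.1, (hc t).2.2.2.1]
    apply Complex.ext <;> simp <;> ring
  have hr' : ∀ t, 2 * conj (Φ t 0 0) * Φ t 1 0 = Q.r₁ t - Q.r₂ t * Complex.I := fun t => by
    have := congrArg conj (hr t)
    simp [Complex.conj_ofNat] at this
    linear_combination this
  have hα : ∀ t, 2 * (Φ t 0 0 * conj (Φ t 0 0)) = 1 + Q.r₃ t := fun t => by
    have h1 := (entries_of_mem (hm.mem t)).2.2.2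
    rw [hu, height_eq (hm.mem t), Complex.mul_conj, Complex.ofReal_sub]
    have h2 : (Complex.normSq (Φ t 0 0) : ℂ) + Complex.normSq (Φ t 1 0) = 1 := by exact_mod_cast h1
    linear_combination h2
  have hγ : ∀ t, 2 * (Φ t 1 0 * conj (Φ t 1 0)) = 1 - Q.r₃ t := fun t => by
    have h1 := (entries_of_mem (hm.mem t)).2.2.2
    rw [hu, height_eq (hm.mem t), Complex.mul_conj, Complex.ofReal_sub]
    have h2 : (Complex.normSq (Φ t 0 0) : ℂ) + Complex.normSq (Φ t 1 0) = 1 := by exact_mod_cast h1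
    linear_combination h2
  refine ⟨Q.rate, Q.accel A C p s, hm.mem, fun t => ?_, hQ.rate_hasDerivAt hA hp hs, fun t => ?_,
    fun t => ?_, fun t => ?_, fun t => ?_, fun t => ?_, fun t => ?_⟩
  · rw [show (fun t => height (Φ t)) = Q.r₃ from funext fun t => (hu t).symm]
    exact hQ.r₃ t
  · rw [← hu]
    exact hQ.abs_r₃_le t
  · rw [← hu, ← hQ.cubic_r₃ hA.ne' hp.ne', hh', hl', hn']
  · rw [← hu, hQ.accel_eq hA hp hs, hh', hl', hn']
  · rw [← hu]
    exact hQ.accel_nonneg hA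
  · refine ⟨_, ((hm.kinematic t 0 0).mul (hexp t)).congr_of_eventuallyEq
      (Filter.Eventually.of_forall fun t => (cayleyKlein_apply A C n Φ t 0).1), ?_⟩
    have hκ : (((l + n) / A : ℝ) : ℂ) =
        Q.w₃ t + Q.spin t - ((1 / C - 1 / A) * n : ℝ) * (1 + Q.r₃ t) := by
      rw [← hl' t, ← hn' t]
      simp only [Coords.m₃]
      push_cast
      have : (A : ℂ) ≠ 0 := by exact_mod_cast hA.ne'
      have : (C : ℂ) ≠ 0 := by exact_mod_cast hC.ne'
      field_simp
      ring
    rw [(cayleyKlein_apply A C n Φ t 0).1, (hc t).1, ← hu, hκ, hrate, hspin]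
    generalize Complex.exp (-(Complex.I / 2 * (((1 / C - 1 / A) * n * t : ℝ) : ℂ))) = E
    have hd : (vec (Q.w₁ t) (Q.w₂ t) (Q.w₃ t) * Φ t) 0 0 = Complex.I / 2 *
        (Q.w₃ t * Φ t 0 0 + (Q.w₁ t + Q.w₂ t * Complex.I) * Φ t 1 0) := by
      simp [vec, Matrix.mul_apply, Fin.sum_univ_two]
      ring
    rw [hd]
    have hI := Complex.I_mul_I
    linear_combination (-(Complex.I * E) * (Q.w₁ t + Q.w₂ t * Complex.I) * Φ t 1 0) * hα t
      + (Complex.I * E * Φ t 0 0) * (Q.w₁ t + Q.w₂ t * Complex.I) * hr' t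
      + E * Φ t 0 0 * (Q.w₂ t * Q.r₁ t - Q.w₁ t * Q.r₂ t - Complex.I * Q.w₂ t * Q.r₂ t) * hI
  · refine ⟨_, ((hm.kinematic t 1 0).mul (hexp t)).congr_of_eventuallyEq
      (Filter.Eventually.of_forall fun t => (cayleyKlein_apply A C n Φ t 1).1), ?_⟩
    have hκ : (((l - n) / A : ℝ) : ℂ) =
        Q.w₃ t - Q.spin t + ((1 / C - 1 / A) * n : ℝ) * (1 - Q.r₃ t) := by
      rw [← hl' t, ← hn' t]
      simp only [Coords.m₃]
      push_cast
      have : (A : ℂ) ≠ 0 := by exact_mod_cast hA.ne'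
      have : (C : ℂ) ≠ 0 := by exact_mod_cast hC.ne'
      field_simp
      ring
    rw [(cayleyKlein_apply A C n Φ t 1).1, (hc t).1, ← hu, hκ, hrate, hspin]
    generalize Complex.exp (-(Complex.I / 2 * (((1 / C - 1 / A) * n * t : ℝ) : ℂ))) = E
    have hd : (vec (Q.w₁ t) (Q.w₂ t) (Q.w₃ t) * Φ t) 1 0 = Complex.I / 2 *
        ((Q.w₁ t - Q.w₂ t * Complex.I) * Φ t 0 0 - Q.w₃ t * Φ t 1 0) := by
      simp [vec, Matrix.mul_apply, Fin.sum_univ_two]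
      ring
    rw [hd]
    have hI := Complex.I_mul_I
    linear_combination (-(Complex.I * E) * (Q.w₁ t - Q.w₂ t * Complex.I) * Φ t 0 0) * hγ t
      + (Complex.I * E * Φ t 1 0) * (Q.w₁ t - Q.w₂ t * Complex.I) * hr t
      + E * Φ t 1 0 * (Q.w₁ t * Q.r₂ t - Q.w₂ t * Q.r₁ t - Complex.I * Q.w₂ t * Q.r₂ t) * hI

end CayleyKlein

end ToyTop

/-! ### The change from time to the uniformizing variable -/

namespace ToyTop

open Filter

/-- Reparametrization of time: the inverse of a primitive of a positive function. -/
lemma exists_inverse_primitive {g : ℝ → ℝ} (hg : Continuous g) {c : ℝ} (hc : 0 < c)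
    (hgc : ∀ t, c ≤ g t) :
    ∃ T : ℝ → ℝ, T 0 = 0 ∧ Function.Bijective T ∧ ∀ y, HasDerivAt T (g (T y))⁻¹ y := by
  set Y : ℝ → ℝ := fun t => ∫ x in (0 : ℝ)..t, g x with hY
  have hd : ∀ t, HasDerivAt Y (g t) t := fun t => hg.integral_hasStrictDerivAt 0 t |>.hasDerivAt
  have hpos : ∀ t, 0 < g t := fun t => hc.trans_le (hgc t)
  have hmono : StrictMono Y := strictMono_of_hasDerivAt_pos hd hpos
  have hcont : Continuous Y := continuous_iff_continuousAt.mpr fun t => (hd t).continuousAt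
  have hlin : Monotone fun t => Y t - c * t := monotone_of_hasDerivAt_nonneg
    (fun t => (hd t).sub ((hasDerivAt_id t).const_mul c)) fun t => by simpa using hgc t
  have hY0 : Y 0 = 0 := by simp [hY]
  have htop : Tendsto Y atTop atTop := by
    refine tendsto_atTop_mono' _ ?_ (tendsto_id.const_mul_atTop hc)
    filter_upwards [eventually_ge_atTop 0] with t ht
    have := hlin ht
    simp only [hY0, mul_zero, sub_zero, id] at this ⊢
    linarith
  have hbot : Tendsto Y atBot atBot := by
    refine tendsto_atBot_mono' _ ?_ (tendsto_id.const_mul_atBot hc)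
    filter_upwards [eventually_le_atBot 0] with t ht
    have := hlin ht
    simp only [hY0, mul_zero, sub_zero, id] at this ⊢
    linarith
  let e := (hmono.orderIsoOfSurjective Y (hcont.surjective htop hbot))
  have hr : ∀ y, Y (e.symm y) = y := e.apply_symm_apply
  refine ⟨e.symm, ?_, e.symm.bijective, fun y => ?_⟩
  · exact hmono.injective (by rw [hr, hY0])
  · exact (hd _).of_local_left_inverse e.symm.continuous.continuousAt (hpos _).ne'
      (Eventually.of_forall hr)

variable {A C p s h l n e₁ e₂ e₃ : ℝ} {Φ : ℝ → Mat} {u₁ u₂ : ℝ → ℝ} {L : PeriodPair}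

lemma deriv_cubic_eq
    (hroots : ∀ v : ℝ, cubic A C p h l n v = (v - e₁) * (v - e₂) * (v - e₃)) (v : ℝ) :
    deriv (cubic A C p h l n) v =
      (v - e₁) * (v - e₂) + (v - e₁) * (v - e₃) + (v - e₂) * (v - e₃) := by
  rw [funext hroots]
  have hd : ∀ e, HasDerivAt (fun v : ℝ => v - e) 1 v := fun e => (hasDerivAt_id v).sub_const e
  have := ((hd e₁).mul (hd e₂)).mul (hd e₃)
  refine HasDerivAt.deriv (this.congr_deriv ?_)
  simp only [Pi.mul_apply]
  ring

/-- The values of `w` over `u = ∓1`: there the cubic polynomial is, up to a factor, the square of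
`l ± n`. -/
lemma sq_eq_R (hA : A ≠ 0) (hp : p ≠ 0) (hs : 0 < s)
    (hroots : ∀ v : ℝ, cubic A C p h l n v = (v - e₁) * (v - e₂) * (v - e₃))
    (he : p * s * e₃ ^ 2 = p * s + A) :
    (√(2 * s) * (e₃ - 1) * ((l + n) / A)) ^ 2 = R e₁ e₂ e₃ (-1) ∧
      (√(2 * s) * (e₃ + 1) * ((l - n) / A)) ^ 2 = R e₁ e₂ e₃ 1 := by
  have hm : (l + n) ^ 2 = 2 * A * p * ((-1 - e₁) * (-1 - e₂) * (1 + e₃)) := by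
    have := hroots (-1)
    simp only [cubic] at this
    field_simp at this
    linear_combination -this
  have hp' : (l - n) ^ 2 = 2 * A * p * ((1 - e₁) * (1 - e₂) * (e₃ - 1)) := by
    have := hroots 1
    simp only [cubic] at this
    field_simp at this
    linear_combination -this
  have hsq : √(2 * s) ^ 2 = 2 * s := Real.sq_sqrt (by positivity)
  constructor
  · rw [mul_pow, mul_pow, hsq, div_pow, hm, R]
    field_simp
    linear_combination 4 * (-1 - e₁) * (-1 - e₂) * (e₃ - 1) * he
  · rw [mul_pow, mul_pow, hsq, div_pow, hp', R]
    field_simp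
    linear_combination 4 * (1 - e₁) * (1 - e₂) * (e₃ + 1) * he

namespace ReducedMotion

/-- The first-order equation of the height, after division by `e₃ - u > 0`. -/
lemma first_order_eq (hr : ReducedMotion A C p s h l n Φ u₁ u₂) (hp : p ≠ 0)
    (hroots : ∀ v : ℝ, cubic A C p h l n v = (v - e₁) * (v - e₂) * (v - e₃))
    (he : p * s * e₃ ^ 2 = p * s + A) (he3 : 1 < e₃) (t : ℝ) :
    s * (e₃ + ToyTop.height (Φ t)) * u₁ t ^ 2 =
      -2 * ((ToyTop.height (Φ t) - e₁) * (ToyTop.height (Φ t) - e₂)) := by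
  have h1 := hr.first_order t
  rw [hroots] at h1
  have h2 : e₃ - ToyTop.height (Φ t) ≠ 0 := by linarith [(hr.mem_Icc t).2]
  apply mul_left_cancel₀ (mul_ne_zero hp h2)
  linear_combination -2 * h1 + u₁ t ^ 2 * he

lemma velocity_zero (hr : ReducedMotion A C p s h l n Φ u₁ u₂) (hp : p ≠ 0) (hs : 0 < s)
    (hroots : ∀ v : ℝ, cubic A C p h l n v = (v - e₁) * (v - e₂) * (v - e₃))
    (he : p * s * e₃ ^ 2 = p * s + A) (he3 : 1 < e₃) (hu : ToyTop.height (Φ 0) = e₂) :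
    u₁ 0 = 0 := by
  have h1 := hr.first_order_eq hp hroots he he3 0
  have h2 : 0 < s * (e₃ + ToyTop.height (Φ 0)) := mul_pos hs (by linarith [(hr.mem_Icc 0).1])
  rw [hu, sub_self, mul_zero, mul_zero] at h1
  rw [hu] at h2
  exact pow_eq_zero_iff two_ne_zero |>.mp ((mul_eq_zero.mp h1).resolve_left h2.ne')

/-- The axis does not start vertically downward: there `e₂ = -1` would be the larger of the turning
points `e₁`, `e₂`, hence a maximum of the height. -/
lemma neg_one_lt (hr : ReducedMotion A C p s h l n Φ u₁ u₂) (hA : 0 < A) (hp : 0 < p) (hs : 0 < s)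
    (hroots : ∀ v : ℝ, cubic A C p h l n v = (v - e₁) * (v - e₂) * (v - e₃)) (h12 : e₁ < e₂)
    (he : p * s * e₃ ^ 2 = p * s + A) (he3 : 1 < e₃) (hu : ToyTop.height (Φ 0) = e₂) :
    -1 < e₂ := by
  refine lt_of_le_of_ne (hu ▸ (hr.mem_Icc 0).1) fun h => ?_
  have h1 := hr.lowest 0 (hu.trans h.symm)
  have h2 := hr.second_order 0
  rw [deriv_cubic_eq hroots, hr.velocity_zero hp.ne' hs hroots he he3 hu, hu, ← h] at h2
  rw [← h] at h12
  have h3 : 0 < p * ((-1 - e₁) * (1 + e₃)) := mul_pos hp (mul_pos (by linarith) (by linarith))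
  nlinarith [mul_nonneg hA.le h1]

/-- The change of the independent variable from time to `x = i y`. -/
lemma exists_timeChange (hr : ReducedMotion A C p s h l n Φ u₁ u₂) (hp : 0 < p) (hs : 0 < s)
    (hroots : ∀ v : ℝ, cubic A C p h l n v = (v - e₁) * (v - e₂) * (v - e₃)) (h12 : e₁ < e₂)
    (he : p * s * e₃ ^ 2 = p * s + A) (he3 : 1 < e₃) (hu : ToyTop.height (Φ 0) = e₂)
    (hL : IsPeriodPair e₁ e₂ e₃ L) (hinv : HasInvariants e₁ e₂ e₃ L) :
    ∃ T : ℝ → ℝ, T 0 = 0 ∧ Function.Bijective T ∧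
      (∀ y, HasDerivAt T (√(2 * s) * (ToyTop.height (Φ (T y)) + e₃)) y) ∧
      (∀ t y, TimeAt s e₁ e₂ e₃ L t y ↔ t = T y) ∧
      ∀ y : ℝ, uFun e₁ e₂ e₃ L (y * Complex.I) = ToyTop.height (Φ (T y)) ∧
        wFun L (y * Complex.I) * Complex.I =
          (√(2 * s) * (ToyTop.height (Φ (T y)) + e₃) * u₁ (T y) : ℝ) := by
  have hs2 : 0 < √(2 * s) := Real.sqrt_pos.mpr (by positivity)
  have hsq : √(2 * s) ^ 2 = 2 * s := Real.sq_sqrt (by positivity)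
  have hpos : ∀ t, 0 < √(2 * s) * (ToyTop.height (Φ t) + e₃) := fun t =>
    mul_pos hs2 (by linarith [(hr.mem_Icc t).1])
  have hcont : Continuous fun t => ToyTop.height (Φ t) :=
    continuous_iff_continuousAt.mpr fun t => (hr.height t).continuousAt
  obtain ⟨T, hT0, hTb, hT⟩ := exists_inverse_primitive
    (g := fun t => (√(2 * s) * (ToyTop.height (Φ t) + e₃))⁻¹)
    ((continuous_const.mul (hcont.add continuous_const)).inv₀ fun t => (hpos t).ne')
    (c := (√(2 * s) * (1 + e₃))⁻¹) (by positivity) fun t =>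
      inv_anti₀ (hpos t) (mul_le_mul_of_nonneg_left (by linarith [(hr.mem_Icc t).2]) hs2.le)
  simp only [inv_inv] at hT
  have hU : ∀ y, HasDerivAt (fun y => ToyTop.height (Φ (T y)))
      (√(2 * s) * (ToyTop.height (Φ (T y)) + e₃) * u₁ (T y)) y := fun y =>
    ((hr.height (T y)).comp y (hT y)).congr_deriv (by ring)
  have hV : ∀ y, HasDerivAt (fun y => √(2 * s) * (ToyTop.height (Φ (T y)) + e₃) * u₁ (T y))
      (-(2 * ((ToyTop.height (Φ (T y)) - e₁) * (ToyTop.height (Φ (T y)) - e₂)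
        + (ToyTop.height (Φ (T y)) - e₁) * (ToyTop.height (Φ (T y)) + e₃)
        + (ToyTop.height (Φ (T y)) - e₂) * (ToyTop.height (Φ (T y)) + e₃)))) y := fun y => by
    refine ((((hU y).add_const e₃).const_mul (√(2 * s))).mul
      ((hr.velocity (T y)).comp y (hT y))).congr_deriv ?_
    have h1 := hr.second_order (T y)
    have h2 := hr.first_order_eq hp.ne' hroots he he3 (T y)
    rw [deriv_cubic_eq hroots] at h1
    simp only [Function.comp_apply]
    have h3 : e₃ - ToyTop.height (Φ (T y)) ≠ 0 := by linarith [(hr.mem_Icc (T y)).2]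
    generalize ToyTop.height (Φ (T y)) = u at h1 h2 h3 ⊢
    apply mul_left_cancel₀ (mul_ne_zero hp.ne' h3)
    linear_combination (p * (e₃ - u) * ((u + e₃) * u₁ (T y) ^ 2 + (u + e₃) ^ 2 * u₂ (T y))) * hsq
      + 2 * (u + e₃) * h1 + 2 * (u + e₃) * u₂ (T y) * he + 2 * p * e₃ * h2
  have hmain := uFun_imaginary hL hinv h12
    (by linarith [hu ▸ (hr.mem_Icc 0).1]) hU hV (by rw [hT0, hu])
    (by rw [hT0, hr.velocity_zero hp.ne' hs hroots he he3 hu, mul_zero])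
  refine ⟨T, hT0, hTb, hT, fun t y => ?_, hmain⟩
  have hint : ∫ η in (0 : ℝ)..y, (√(2 * s) * (ToyTop.height (Φ (T η)) + e₃)) = T y := by
    rw [intervalIntegral.integral_eq_sub_of_hasDerivAt (fun η _ => hT η), hT0, sub_zero]
    refine Continuous.intervalIntegrable ?_ _ _
    exact continuous_const.mul ((continuous_iff_continuousAt.mpr fun y =>
      (hU y).continuousAt).add continuous_const)
  have : -Complex.I * (√(2 * s) : ℂ) *
      ∫ η in (0 : ℝ)..y, (uFun e₁ e₂ e₃ L (η * Complex.I) + e₃) * Complex.I = T y := by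
    rw [← hint, ← intervalIntegral.integral_ofReal, ← intervalIntegral.integral_const_mul]
    congr 1
    funext η
    rw [(hmain η).1]
    push_cast
    linear_combination (-(√(2 * s) : ℂ) * (ToyTop.height (Φ (T η)) + e₃)) * Complex.I_mul_I
  rw [TimeAt, this, Complex.ofReal_inj]

end ReducedMotion

end ToyTop

/-! ### Quotients of `σ`-functions on the imaginary axis -/

/-- Two curves with the same logarithmic derivative off a countable set, and with the same initial
value, coincide, provided that the zeros of the second are simple and are zeros of the first: the
quotient is then continuous, with derivative zero off a countable set. -/
lemma eq_of_deriv_mul_eq {f F f' F' : ℝ → ℂ} (hf : ∀ y, HasDerivAt f (f' y) y)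
    (hF : ∀ y, HasDerivAt F (F' y) y) (hzero : ∀ y, F y = 0 → f y = 0 ∧ F' y ≠ 0)
    {S : Set ℝ} (hS : S.Countable) (hS' : ∀ y ∉ S, F y ≠ 0 ∧ f' y * F y = f y * F' y)
    (h0 : f 0 = F 0) (hF0 : F 0 ≠ 0) (y : ℝ) : f y = F y := by
  classical
  set q : ℝ → ℂ := fun y => if F y = 0 then f' y / F' y else f y / F y with hq
  have hqne : ∀ y, F y ≠ 0 → q y = f y / F y := fun y hy => if_neg hy
  have hev : ∀ y, F y ≠ 0 → q =ᶠ[𝓝 y] fun y => f y / F y := fun y hy =>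
    ((hF y).continuousAt.eventually_ne hy).mono hqne
  have hcont : Continuous q := by
    refine continuous_iff_continuousAt.mpr fun y => ?_
    by_cases hy : F y = 0
    · obtain ⟨hy', hF'⟩ := hzero y hy
      rw [continuousAt_iff_punctured_nhds]
      have h1 := (hasDerivAt_iff_tendsto_slope.mp (hf y)).div
        (hasDerivAt_iff_tendsto_slope.mp (hF y)) hF'
      have h2 : q y = f' y / F' y := if_pos hy
      rw [h2]
      refine h1.congr' ?_
      filter_upwards [(hF y).eventually_ne hF' (c := 0), self_mem_nhdsWithin] with z hz hne
      rw [hqne z hz, Pi.div_apply, slope_def_module, slope_def_module, hy, hy', sub_zero, sub_zero,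
        Complex.real_smul, Complex.real_smul, mul_div_mul_left _ _
        (by exact_mod_cast inv_ne_zero (sub_ne_zero.mpr hne))]
    · exact (((hf y).continuousAt.div (hF y).continuousAt hy)).congr (hev y hy).symm
  have hd : ∀ y ∉ S, HasDerivAt q 0 y := fun y hy => by
    obtain ⟨h1, h2⟩ := hS' y hy
    refine (((hf y).div (hF y) h1).congr_of_eventuallyEq (hev y h1)).congr_deriv ?_
    rw [h2, sub_self, zero_div]
  have hint := MeasureTheory.integral_eq_of_hasDerivAt_off_countable q (fun _ => 0)
    (a := 0) (b := y) hS hcont.continuousOn (fun x hx => hd x hx.2) (by simp)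
  rw [intervalIntegral.integral_zero] at hint
  have h1 : q y = 1 := by
    rw [sub_eq_zero.mp hint.symm, hqne 0 hF0, h0, div_self hF0]
  by_cases hy : F y = 0
  · rw [hy, (hzero y hy).1]
  · rw [hqne y hy] at h1
    exact (div_eq_one_iff_eq hy).mp h1

namespace ToyTop

open Filter

variable {s e₁ e₂ e₃ : ℝ} {L : PeriodPair}

/-- The function `K e^{ν x} σ(x - c) / σ(x - ω₂)`. -/
noncomputable def sigmaQuotient (L : PeriodPair) (K ν c x : ℂ) : ℂ :=
  K * Complex.exp (ν * x) * (L.weierstrassSigma (x - c) / L.weierstrassSigma (x - halfPeriod L))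

lemma sigmaQuotient_neg (L : PeriodPair) (K ν c x : ℂ) :
    sigmaQuotient L K ν c (-x) = K * Complex.exp (-ν * x) *
      (L.weierstrassSigma (x + c) / L.weierstrassSigma (x + halfPeriod L)) := by
  rw [sigmaQuotient, show -x - c = -(x + c) by ring,
    show -x - halfPeriod L = -(x + halfPeriod L) by ring, L.weierstrassSigma_neg,
    L.weierstrassSigma_neg, neg_div_neg_eq, mul_neg, neg_mul]

lemma uFun_neg (x : ℂ) : uFun e₁ e₂ e₃ L (-x) = uFun e₁ e₂ e₃ L x := by
  have h := L.weierstrassP_add_coe (x - halfPeriod L) ⟨L.ω₂, L.ω₂_mem_lattice⟩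
  have h2 : x - halfPeriod L + L.ω₂ = -(-x - halfPeriod L) := by rw [halfPeriod]; ring
  simp only [h2, L.weierstrassP_neg] at h
  rw [uFun, uFun, h]

lemma wFun_neg (x : ℂ) : wFun L (-x) = -wFun L x := by
  have h := L.derivWeierstrassP_add_coe (x - halfPeriod L) ⟨L.ω₂, L.ω₂_mem_lattice⟩
  have h2 : x - halfPeriod L + L.ω₂ = -(-x - halfPeriod L) := by rw [halfPeriod]; ring
  simp only [h2, L.derivWeierstrassP_neg] at h
  rw [wFun, wFun, ← h, neg_neg]

lemma uFun_eq_of_sub_mem {x c : ℂ} (h : x - c ∈ L.lattice) :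
    uFun e₁ e₂ e₃ L x = uFun e₁ e₂ e₃ L c := by
  have := L.weierstrassP_add_coe (c - halfPeriod L) ⟨x - c, h⟩
  rw [uFun, uFun, ← this]
  congr 2
  ring

/-- The logarithmic derivative of the `σ`-quotient, by the addition theorem of the `ζ`-function. -/
lemma hasDerivAt_sigmaQuotient {c x K μ : ℂ} {u₀ w₀ : ℝ} (hc : LiesOver e₁ e₂ e₃ L c u₀ w₀)
    (hx : x - halfPeriod L ∉ L.lattice) (hu : uFun e₁ e₂ e₃ L x ≠ u₀) :
    HasDerivAt (sigmaQuotient L K (μ + L.weierstrassZeta (c - halfPeriod L)) c)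
      ((μ + (wFun L x + w₀) / (2 * (uFun e₁ e₂ e₃ L x - u₀))) *
        sigmaQuotient L K (μ + L.weierstrassZeta (c - halfPeriod L)) c x) x := by
  set ν := μ + L.weierstrassZeta (c - halfPeriod L) with hν
  have hxc : x - c ∉ L.lattice := fun h => hu ((uFun_eq_of_sub_mem h).trans hc.u_eq)
  have hY : halfPeriod L - c ∉ L.lattice := fun h => hc.not_pole (by
    simpa using neg_mem h)
  have hYn : halfPeriod L - c = -(c - halfPeriod L) := by ring
  have hPx : L.weierstrassP (x - halfPeriod L) =
      uFun e₁ e₂ e₃ L x - ((1 / 3 * (e₁ + e₂ - e₃) : ℝ) : ℂ) := by rw [uFun]; ring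
  have hPY : L.weierstrassP (halfPeriod L - c) =
      u₀ - ((1 / 3 * (e₁ + e₂ - e₃) : ℝ) : ℂ) := by
    rw [hYn, L.weierstrassP_neg, ← hc.u_eq, uFun]; ring
  have hP'Y : L.derivWeierstrassP (halfPeriod L - c) = -w₀ := by
    rw [hYn, L.derivWeierstrassP_neg, ← hc.w_eq, wFun]
  have hxY : (x - halfPeriod L) + (halfPeriod L - c) = x - c := by ring
  have hadd := L.weierstrassZeta_add hx hY (by rw [hxY]; exact hxc) (by
    rw [hPx, hPY]; exact fun h => hu (by linear_combination h))
  rw [hxY, PeriodPair.addQuotient, hPx, hPY, hP'Y, hYn, L.weierstrassZeta_neg] at hadd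
  have hσ := L.weierstrassSigma_ne_zero hx
  have h1 : HasDerivAt (fun x : ℂ => K * Complex.exp (ν * x))
      (K * (Complex.exp (ν * x) * ν)) x := by
    have := ((hasDerivAt_id x).const_mul ν).cexp.const_mul K
    simpa using this
  have h2 := ((L.hasDerivAt_weierstrassSigma hxc).comp_sub_const x c).div
    ((L.hasDerivAt_weierstrassSigma hx).comp_sub_const x (halfPeriod L)) hσ
  refine (h1.mul h2).congr_deriv ?_
  have hw : wFun L x = L.derivWeierstrassP (x - halfPeriod L) := rfl
  rw [hadd, ← hw, sigmaQuotient, hν,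
    show uFun e₁ e₂ e₃ L x - ((1 / 3 * (e₁ + e₂ - e₃) : ℝ) : ℂ) -
      (u₀ - ((1 / 3 * (e₁ + e₂ - e₃) : ℝ) : ℂ)) = uFun e₁ e₂ e₃ L x - u₀ by ring]
  simp only [Pi.div_apply]
  field_simp
  ring

/-- The `σ`-quotient has simple zeros. -/
lemma exists_hasDerivAt_sigmaQuotient_of_mem {c x K : ℂ} (ν : ℂ) (hK : K ≠ 0)
    (hx : x - halfPeriod L ∉ L.lattice) (hxc : x - c ∈ L.lattice) :
    ∃ d ≠ 0, HasDerivAt (sigmaQuotient L K ν c) d x := by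
  have hσ := L.weierstrassSigma_ne_zero hx
  have h0 := (L.weierstrassSigma_eq_zero_iff).mpr hxc
  have h1 : HasDerivAt (fun x : ℂ => K * Complex.exp (ν * x))
      (K * (Complex.exp (ν * x) * ν)) x := by
    have := ((hasDerivAt_id x).const_mul ν).cexp.const_mul K
    simpa using this
  have h2 := ((L.differentiable_weierstrassSigma (x - c)).hasDerivAt.comp_sub_const x c).div
    ((L.hasDerivAt_weierstrassSigma hx).comp_sub_const x (halfPeriod L)) hσ
  refine ⟨_, ?_, h1.mul h2⟩
  simp only [h0, zero_div, mul_zero, zero_mul, zero_add, sub_zero]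
  exact mul_ne_zero (mul_ne_zero hK (Complex.exp_ne_zero _)) (div_ne_zero
    (mul_ne_zero (L.deriv_weierstrassSigma_ne_zero hxc) hσ) (pow_ne_zero 2 hσ))

/-- A curve that satisfies the differential equation of the `σ`-quotient along the imaginary axis,
and vanishes where that equation is singular, is a `σ`-quotient. -/
lemma eq_sigmaQuotient (hL : IsPeriodPair e₁ e₂ e₃ L) {c K μ : ℂ} {u₀ w₀ : ℝ}
    (hc : LiesOver e₁ e₂ e₃ L c u₀ w₀) (hcL : c ∉ L.lattice) (hK : K ≠ 0) {f f' : ℝ → ℂ}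
    (hf : ∀ y, HasDerivAt f (f' y) y)
    (hode : ∀ y : ℝ, 2 * (uFun e₁ e₂ e₃ L (y * Complex.I) - u₀) * f' y = Complex.I *
      (wFun L (y * Complex.I) + w₀ + 2 * μ * (uFun e₁ e₂ e₃ L (y * Complex.I) - u₀)) * f y)
    (hzero : ∀ y : ℝ, uFun e₁ e₂ e₃ L (y * Complex.I) = u₀ → f y = 0)
    (h0 : f 0 = K * (L.weierstrassSigma c / L.weierstrassSigma (halfPeriod L))) (y : ℝ) :
    f y = sigmaQuotient L K (μ + L.weierstrassZeta (c - halfPeriod L)) c (y * Complex.I) := by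
  set ν := μ + L.weierstrassZeta (c - halfPeriod L)
  have hline : ∀ y : ℝ, HasDerivAt (fun y : ℝ => (y : ℂ) * Complex.I) Complex.I y := fun y => by
    simpa using (Complex.ofRealCLM.hasDerivAt (x := y)).mul_const Complex.I
  have hpole := hL.sub_halfPeriod_notMem
  have hd : ∀ y : ℝ, ∃ d, HasDerivAt (sigmaQuotient L K ν c) d (y * Complex.I) ∧
      (y * Complex.I - c ∈ L.lattice → d ≠ 0) := fun y => by
    by_cases h : y * Complex.I - c ∈ L.lattice
    · obtain ⟨d, hd, hd'⟩ := exists_hasDerivAt_sigmaQuotient_of_mem ν hK (hpole y) h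
      exact ⟨d, hd', fun _ => hd⟩
    · have h1 : HasDerivAt (fun x : ℂ => K * Complex.exp (ν * x))
          (K * (Complex.exp (ν * (y * Complex.I)) * ν)) (y * Complex.I) := by
        have := ((hasDerivAt_id (y * Complex.I)).const_mul ν).cexp.const_mul K
        simpa using this
      exact ⟨_, h1.mul (((L.hasDerivAt_weierstrassSigma h).comp_sub_const _ c).div
        ((L.hasDerivAt_weierstrassSigma (hpole y)).comp_sub_const _ (halfPeriod L))
        (L.weierstrassSigma_ne_zero (hpole y))), fun h' => absurd h' h⟩
  choose d hd hd' using hd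
  have hq0 : ∀ y : ℝ, sigmaQuotient L K ν c (y * Complex.I) = 0 ↔ y * Complex.I - c ∈ L.lattice :=
    fun y => by
      rw [sigmaQuotient, mul_eq_zero, or_iff_right (mul_ne_zero hK (Complex.exp_ne_zero _)),
        div_eq_zero_iff, or_iff_left (L.weierstrassSigma_ne_zero (hpole y)),
        L.weierstrassSigma_eq_zero_iff]
  refine eq_of_deriv_mul_eq (S := {y : ℝ | uFun e₁ e₂ e₃ L (y * Complex.I) = u₀}) hf
    (fun y => (hd y).comp_of_eq y (hline y) rfl) (fun y hy => ?_) ?_ (fun y hy => ?_) ?_ ?_ y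
  · have hy' := (hq0 y).mp hy
    exact ⟨hzero y ((uFun_eq_of_sub_mem hy').trans hc.u_eq),
      mul_ne_zero (hd' y hy') Complex.I_ne_zero⟩
  · refine ((L.countable_weierstrassP_eq
      (u₀ - ((1 / 3 * (e₁ + e₂ - e₃) : ℝ) : ℂ))).preimage_of_injOn
      (f := fun y : ℝ => (y : ℂ) * Complex.I - halfPeriod L) ?_).mono ?_
    · intro x _ z _ h
      have := mul_right_cancel₀ Complex.I_ne_zero (sub_left_inj.mp h)
      exact_mod_cast this
    · intro y hy
      simp only [Set.mem_ofPred_eq, uFun, Set.mem_preimage] at hy ⊢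
      rw [← hy]
      ring
  · have hu : uFun e₁ e₂ e₃ L (y * Complex.I) - u₀ ≠ 0 := sub_ne_zero.mpr hy
    constructor
    · exact fun h => hy ((uFun_eq_of_sub_mem ((hq0 y).mp h)).trans hc.u_eq)
    · rw [(hd y).unique (hasDerivAt_sigmaQuotient (μ := μ) hc (hpole y) hy)]
      have h := hode y
      simp only [Function.comp_apply]
      generalize sigmaQuotient L K ν c (y * Complex.I) = G
      generalize uFun e₁ e₂ e₃ L (y * Complex.I) = u at h hu ⊢
      field_simp
      linear_combination G * h
  · rw [h0]
    simp [sigmaQuotient, L.weierstrassSigma_neg]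
  · rw [Function.comp_apply, ne_eq, hq0]
    intro h
    refine hcL ?_
    simpa using neg_mem h

/-- A quotient of entire functions without common zeros that represents a function of time on the
imaginary axis is also its analytic continuation: a continuation into a zero of the denominator
would have a common zero there. -/
lemma isGivenBy_of_eq {T : ℝ → ℝ} (hT : ∀ t y, TimeAt s e₁ e₂ e₃ L t y ↔ t = T y) {g : ℝ → ℂ}
    {F N D : ℂ → ℂ} (hN : Differentiable ℂ N) (hD : Differentiable ℂ D)
    (hND : ∀ x, D x = 0 → N x ≠ 0) (hF : ∀ x, F x = N x / D x)
    (hD0 : ∀ y : ℝ, D (y * Complex.I) ≠ 0) (hg : ∀ y : ℝ, g (T y) = F (y * Complex.I)) :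
    IsGivenBy s e₁ e₂ e₃ L g F := by
  refine ⟨fun t y h => by rw [(hT t y).mp h, hg], fun U f hU hUc h0 hf hev x hx => ?_⟩
  have heq : Set.EqOn (fun x => f x * D x) N U := by
    refine AnalyticOnNhd.eqOn_of_preconnected_of_frequently_eq
      (hf.mul (hD.differentiableOn.analyticOnNhd hU)) (hN.differentiableOn.analyticOnNhd hU)
      hUc h0 ?_
    have ht : Tendsto (fun y : ℝ => (y : ℂ) * Complex.I) (𝓝[≠] 0) (𝓝[≠] 0) := by
      rw [tendsto_nhdsWithin_iff]
      constructor
      · have : Continuous fun y : ℝ => (y : ℂ) * Complex.I := by fun_prop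
        simpa using this.continuousAt.tendsto.mono_left (nhdsWithin_le_nhds (a := (0 : ℝ)))
      · filter_upwards [self_mem_nhdsWithin] with y hy
        simpa using hy
    refine ht.frequently (Eventually.frequently ?_)
    filter_upwards [nhdsWithin_le_nhds hev] with y hy
    rw [hy _ ((hT _ y).mpr rfl), hg, hF, div_mul_cancel₀ _ (hD0 y)]
  have hDx : D x ≠ 0 := fun h => hND x h (by
    rw [← heq hx]
    simp [h])
  rw [hF, eq_div_iff hDx]
  exact heq hx

end ToyTop

/-! ### The Cayley-Klein parameters as quotients of `σ`-functions -/

namespace ToyTop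

open ComplexConjugate

variable {s e₁ e₂ e₃ : ℝ} {L : PeriodPair}

/-- A complex function `g` of time that satisfies `2 (u - u₀) g' = (u' + i κ) g`, where `u₀ = ∓1`
for the Cayley-Klein parameters `α` and `γ`, is a `σ`-quotient in `x`, and so is its complex
conjugate. Complex conjugation reverses the sign of `κ`, hence amounts to the reversal of `x`. -/
lemma isGivenBy_sigmaQuotient (hL : IsPeriodPair e₁ e₂ e₃ L) {u u₁ T : ℝ → ℝ} (hT0 : T 0 = 0)
    (hT : ∀ y, HasDerivAt T (√(2 * s) * (u (T y) + e₃)) y)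
    (hTime : ∀ t y, TimeAt s e₁ e₂ e₃ L t y ↔ t = T y)
    (hx : ∀ y : ℝ, uFun e₁ e₂ e₃ L (y * Complex.I) = u (T y) ∧
      wFun L (y * Complex.I) * Complex.I = (√(2 * s) * (u (T y) + e₃) * u₁ (T y) : ℝ))
    {c K ε : ℂ} {u₀ w₀ κ : ℝ} (hc : LiesOver e₁ e₂ e₃ L c u₀ w₀) (hcL : c ∉ L.lattice)
    (hK : K ≠ 0) (hu₀ : u₀ + e₃ ≠ 0) (hw₀ : w₀ = √(2 * s) * (u₀ + e₃) * κ) {g : ℝ → ℂ}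
    (hg : ∀ t, ∃ g', HasDerivAt g g' t ∧
      2 * ((u t : ℂ) - u₀) * g' = (u₁ t + Complex.I * κ) * g t)
    (hzero : ∀ t, u t = u₀ → g t = 0)
    (h0 : g 0 = K * (L.weierstrassSigma c / L.weierstrassSigma (halfPeriod L)))
    (hε : ε * conj (g 0) = g 0) {ν : ℂ}
    (hν : ν = w₀ / (2 * (u₀ + e₃)) + L.weierstrassZeta (c - halfPeriod L)) :
    IsGivenBy s e₁ e₂ e₃ L g (fun x => K * Complex.exp (ν * x) *
        (L.weierstrassSigma (x - c) / L.weierstrassSigma (x - halfPeriod L))) ∧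
      IsGivenBy s e₁ e₂ e₃ L (fun t => ε * conj (g t)) (fun x => K * Complex.exp (-ν * x) *
        (L.weierstrassSigma (x + c) / L.weierstrassSigma (x + halfPeriod L))) := by
  choose g' hg' hode using hg
  have hu₀' : (u₀ : ℂ) + e₃ ≠ 0 := by exact_mod_cast hu₀
  have hμ : 2 * ((w₀ : ℂ) / (2 * (u₀ + e₃))) = √(2 * s) * κ := by
    rw [hw₀]
    push_cast
    field_simp
  have hw₀' : (w₀ : ℂ) = √(2 * s) * (u₀ + e₃) * κ := by rw [hw₀]; push_cast; ring
  have hσ := L.differentiable_weierstrassSigma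
  -- a common zero of numerator and denominator would put a pole of `u` at `c`
  have hsep : ∀ x, L.weierstrassSigma (x - halfPeriod L) = 0 →
      L.weierstrassSigma (x - c) ≠ 0 := fun x h1 h2 => by
    rw [L.weierstrassSigma_eq_zero_iff] at h1 h2
    refine hc.not_pole ?_
    have := sub_mem h1 h2
    rwa [sub_sub_sub_cancel_left] at this
  have hneg : ∀ x d : ℂ, L.weierstrassSigma (x + d) = -L.weierstrassSigma (-x - d) := fun x d => by
    rw [← L.weierstrassSigma_neg]
    congr 1
    ring
  have hpole : ∀ y : ℝ, L.weierstrassSigma (y * Complex.I - halfPeriod L) ≠ 0 := fun y =>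
    L.weierstrassSigma_ne_zero (hL.sub_halfPeriod_notMem y)
  constructor
  · refine isGivenBy_of_eq hTime
      (N := fun x => K * Complex.exp (ν * x) * L.weierstrassSigma (x - c))
      (D := fun x => L.weierstrassSigma (x - halfPeriod L)) (by fun_prop) (by fun_prop)
      (fun x hD => mul_ne_zero (mul_ne_zero hK (Complex.exp_ne_zero _)) (hsep x hD))
      (fun x => (mul_div_assoc _ _ _).symm) hpole ?_
    rw [hν]
    refine eq_sigmaQuotient (f := fun y => g (T y)) hL hc hcL hK
      (fun y => (hg' (T y)).scomp y (hT y)) (fun y => ?_) (fun y hy => ?_) (by rw [hT0, h0])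
    -- `dt/dx` times the equation in `t` is the equation in `x`, since `w₀ = √(2 s) (u₀ + e₃) κ`
    · have h1 := hode (T y)
      have h2 := (hx y).2
      rw [(hx y).1, Complex.real_smul]
      push_cast at h2 ⊢
      linear_combination (√(2 * s) * (u (T y) + e₃) : ℂ) * h1 - g (T y) * h2
        - (Complex.I * g (T y)) * hw₀' - (Complex.I * g (T y) * (u (T y) - u₀)) * hμ
    · rw [(hx y).1] at hy
      exact hzero _ (by exact_mod_cast hy)
  · refine isGivenBy_of_eq hTime
      (N := fun x => K * Complex.exp (-ν * x) * L.weierstrassSigma (x + c))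
      (D := fun x => L.weierstrassSigma (x + halfPeriod L)) (by fun_prop) (by fun_prop)
      (fun x hD => mul_ne_zero (mul_ne_zero hK (Complex.exp_ne_zero _)) ?_)
      (fun x => (mul_div_assoc _ _ _).symm) (fun y => ?_) (fun y => ?_)
    · rw [hneg, neg_eq_zero] at hD
      rw [hneg, neg_ne_zero]
      exact hsep _ hD
    · have := hpole (-y)
      rw [hneg, neg_ne_zero, ← neg_mul]
      exact_mod_cast this
    · rw [← sigmaQuotient_neg, ← neg_mul, ← Complex.ofReal_neg, hν]
      have h1 := eq_sigmaQuotient (f := fun y => ε * conj (g (T (-y)))) hL hc hcL hK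
        (μ := w₀ / (2 * (u₀ + e₃)))
        (fun y => ((((hg' (T (-y))).scomp (-y) (hT (-y))).star.scomp y
          (hasDerivAt_neg y)).const_mul ε)) (fun y => ?_) (fun y hy => ?_)
        (by rw [neg_zero, hT0, hε, h0]) (-y)
      · simpa using h1
      · have h1 := congrArg conj (hode (T (-y)))
        have h2 := (hx (-y)).2
        have h3 := (hx (-y)).1
        rw [Complex.ofReal_neg, neg_mul] at h2 h3
        rw [wFun_neg] at h2
        rw [uFun_neg] at h3
        simp only [map_mul, map_sub, map_add, Complex.conj_ofReal, Complex.conj_I,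
          Complex.conj_ofNat] at h1
        rw [h3]
        simp only [Complex.real_smul, Complex.star_def, map_mul, Complex.conj_ofReal]
        push_cast at h2 ⊢
        linear_combination (-ε * (√(2 * s) * (u (T (-y)) + e₃))) * h1
          + (ε * conj (g (T (-y)))) * h2 - (Complex.I * ε * conj (g (T (-y)))) * hw₀'
          - (Complex.I * ε * conj (g (T (-y))) * (u (T (-y)) - u₀)) * hμ
      · have h3 := (hx (-y)).1
        rw [Complex.ofReal_neg, neg_mul, uFun_neg, hy] at h3
        rw [hzero (T (-y)) (by exact_mod_cast h3.symm), map_zero, mul_zero]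

end ToyTop

theorem mainTheorem4
    (A C p s : ℝ) (hA : 0 < A) (hC : 0 < C) (hp : 0 < p) (hs : 0 < s)
    -- a motion of the toy top, with first integrals `h`, `l`, `n`
    (Φ ω : ℝ → ToyTop.Mat) (hmotion : ToyTop.IsMotion A C p s Φ ω)
    (h l n : ℝ) (hh : h = ToyTop.energy A C p s (Φ 0) (ω 0))
    (hl : l = ToyTop.integralL A C p s (Φ 0) (ω 0))
    (hn : n = ToyTop.integralN A C p s (Φ 0) (ω 0))
    -- its dynamical constants; the case `e₃ = e₄`, with `e₁ < e₂` so that the curve is elliptic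
    (e₁ e₂ e₃ : ℝ)
    (hroots : ∀ v : ℝ, ToyTop.cubic A C p h l n v = (v - e₁) * (v - e₂) * (v - e₃))
    (h12 : e₁ < e₂) (h34 : e₃ = √(1 + A / (p * s)))
    -- initial conditions
    (hu : ToyTop.height (Φ 0) = e₂)
    (hα : 0 ≤ (Φ 0 0 0).re ∧ (Φ 0 0 0).im = 0)
    (hγ : (Φ 0 1 0).re = 0 ∧ 0 ≤ (Φ 0 1 0).im)
    -- periods of the curve, the values of `w` over `u = -1` and `u = 1`, and the points `a`, `b`
    (L : PeriodPair) (hL : ToyTop.IsPeriodPair e₁ e₂ e₃ L)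
    (wm wp : ℝ) (hwm : wm = √(2 * s) * (e₃ - 1) * ((l + n) / A))
    (hwp : wp = √(2 * s) * (e₃ + 1) * ((l - n) / A))
    (a b : ℂ) (ha : ToyTop.LiesOver e₁ e₂ e₃ L a (-1) wm)
    (hb : ToyTop.LiesOver e₁ e₂ e₃ L b 1 wp)
    -- the constants
    (ω₂ k₁ k₂ l₁ l₃ : ℂ) (hω₂ : ω₂ = ToyTop.halfPeriod L)
    (hk₁ : k₁ = (√((1 + e₂) / 2) : ℂ) * (L.weierstrassSigma ω₂ / L.weierstrassSigma a))
    (hk₂ : k₂ = Complex.I * (√((1 - e₂) / 2) : ℂ) *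
      (L.weierstrassSigma ω₂ / L.weierstrassSigma b))
    (hl₁ : l₁ = wm / (2 * (-1 + e₃)) + L.weierstrassZeta (a - ω₂))
    (hl₃ : l₃ = wp / (2 * (1 + e₃)) + L.weierstrassZeta (b - ω₂)) :
    -- the chosen `wm`, `wp` are values of `w` over `u = -1` and `u = 1`
    wm ^ 2 = ToyTop.R e₁ e₂ e₃ (-1) ∧ wp ^ 2 = ToyTop.R e₁ e₂ e₃ 1 ∧
    -- each moment of time corresponds to exactly one point of the imaginary axis
    (∀ t : ℝ, ∃! y : ℝ, ToyTop.TimeAt s e₁ e₂ e₃ L t y) ∧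
    -- the Cayley-Klein parameters `α` and `δ`
    ToyTop.IsGivenBy s e₁ e₂ e₃ L (fun t => ToyTop.cayleyKlein A C n Φ t 0 0)
      (fun x => k₁ * Complex.exp (l₁ * x) *
        (L.weierstrassSigma (x - a) / L.weierstrassSigma (x - ω₂))) ∧
    ToyTop.IsGivenBy s e₁ e₂ e₃ L (fun t => ToyTop.cayleyKlein A C n Φ t 1 1)
      (fun x => k₁ * Complex.exp (-l₁ * x) *
        (L.weierstrassSigma (x + a) / L.weierstrassSigma (x + ω₂))) ∧
    -- the Cayley-Klein parameters `β` and `γ`; if `e₂ = 1` then `σ(b) = 0` and `k₂` is undefined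
    (e₂ ≠ 1 →
      ToyTop.IsGivenBy s e₁ e₂ e₃ L (fun t => ToyTop.cayleyKlein A C n Φ t 0 1)
        (fun x => k₂ * Complex.exp (-l₃ * x) *
          (L.weierstrassSigma (x + b) / L.weierstrassSigma (x + ω₂))) ∧
      ToyTop.IsGivenBy s e₁ e₂ e₃ L (fun t => ToyTop.cayleyKlein A C n Φ t 1 0)
        (fun x => k₂ * Complex.exp (l₃ * x) *
          (L.weierstrassSigma (x - b) / L.weierstrassSigma (x - ω₂)))) := by
  subst hω₂
  have hAps : 0 < A / (p * s) := by positivity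
  have he : p * s * e₃ ^ 2 = p * s + A := by
    rw [h34, Real.sq_sqrt (by positivity)]
    field_simp
  have he3 : 1 < e₃ := by
    rw [h34, Real.lt_sqrt zero_le_one]
    linarith
  obtain ⟨u₁, u₂, hr⟩ := hmotion.reduced hA hC hp hs hh hl hn
  obtain ⟨hRm, hRp⟩ := ToyTop.sq_eq_R hA.ne' hp.ne' hs hroots he
  rw [← hwm] at hRm
  rw [← hwp] at hRp
  have hinv := ToyTop.hasInvariants_of_liesOver ha hb (by norm_num) hRm hRp
  obtain ⟨T, hT0, hTb, hT, hTime, hx⟩ :=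
    hr.exists_timeChange hp hs hroots h12 he he3 hu hL hinv
  have he2 : -1 < e₂ := hr.neg_one_lt hA hp hs hroots h12 he he3 hu
  have he2' : e₂ ≤ 1 := hu ▸ (hr.mem_Icc 0).2
  have hu0 : ToyTop.uFun e₁ e₂ e₃ L 0 = e₂ := ToyTop.uFun_zero hL hinv h12 (by linarith)
  have hσ₂ : L.weierstrassSigma (ToyTop.halfPeriod L) ≠ 0 :=
    L.weierstrassSigma_ne_zero (L.ω₂_div_two_notMem_lattice)
  -- at lattice points `u` takes the value `u(0) = e₂`
  have hnotMem : ∀ {c : ℂ} {v w : ℝ}, ToyTop.LiesOver e₁ e₂ e₃ L c v w → e₂ ≠ v →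
      c ∉ L.lattice := fun {c v w} hc hv h' => hv (by
    have := ToyTop.uFun_eq_of_sub_mem (e₁ := e₁) (e₂ := e₂) (e₃ := e₃) (x := c) (c := 0)
      (by rwa [sub_zero])
    rw [hc.u_eq, hu0] at this
    exact_mod_cast this.symm)
  have hnorm := ToyTop.normSq_cayleyKlein A C n hr.mem
  have hconj := ToyTop.cayleyKlein_conj A C n hr.mem
  have hα0 : ToyTop.cayleyKlein A C n Φ 0 0 0 = (√((1 + e₂) / 2) : ℂ) := by
    have h1 := (hnorm 0).1
    have h2 := (ToyTop.cayleyKlein_apply A C n Φ 0 0).1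
    simp only [mul_zero, Complex.ofReal_zero, neg_zero, Complex.exp_zero, mul_one] at h2
    rw [h2, Complex.normSq_apply, hα.2, hu] at h1
    rw [h2, show (1 + e₂) / 2 = (Φ 0 0 0).re ^ 2 by linarith, Real.sqrt_sq hα.1]
    exact Complex.ext (by simp) (by simp [hα.2])
  have hγ0 : ToyTop.cayleyKlein A C n Φ 0 1 0 = Complex.I * (√((1 - e₂) / 2) : ℂ) := by
    have h1 := (hnorm 0).2
    have h2 := (ToyTop.cayleyKlein_apply A C n Φ 0 1).1
    simp only [mul_zero, Complex.ofReal_zero, neg_zero, Complex.exp_zero, mul_one] at h2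
    rw [h2, Complex.normSq_apply, hγ.1, hu] at h1
    rw [h2, show (1 - e₂) / 2 = (Φ 0 1 0).im ^ 2 by linarith, Real.sqrt_sq hγ.2]
    exact Complex.ext (by simp [hγ.1]) (by simp)
  have hσa := L.weierstrassSigma_ne_zero (hnotMem ha he2.ne')
  have hsqrt : (√((1 + e₂) / 2) : ℂ) ≠ 0 := by
    exact_mod_cast (Real.sqrt_pos.mpr (by linarith)).ne'
  have hδ : ∀ t, ToyTop.cayleyKlein A C n Φ t 1 1 =
      1 * (starRingEnd ℂ) (ToyTop.cayleyKlein A C n Φ t 0 0) := fun t => by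
    rw [one_mul, (hconj t).1]
  have hβ : ∀ t, ToyTop.cayleyKlein A C n Φ t 0 1 =
      -1 * (starRingEnd ℂ) (ToyTop.cayleyKlein A C n Φ t 1 0) := fun t => by
    rw [neg_one_mul, (hconj t).2]
  have hαδ := ToyTop.isGivenBy_sigmaQuotient (u := fun t => ToyTop.height (Φ t))
    (g := fun t => ToyTop.cayleyKlein A C n Φ t 0 0) (K := k₁) (ε := 1) (κ := (l + n) / A)
    (ν := l₁) hL hT0 hT hTime hx ha (hnotMem ha he2.ne')
    (by rw [hk₁]; exact mul_ne_zero hsqrt (div_ne_zero hσ₂ hσa)) (by linarith)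
    (by rw [hwm]; ring)
    (fun t => by
      obtain ⟨f', h1, h2⟩ := hr.alpha t
      refine ⟨f', h1, ?_⟩
      rw [← h2]
      push_cast
      ring)
    (fun t ht => by
      have h1 := (hnorm t).1
      rw [ht] at h1
      exact Complex.normSq_eq_zero.mp (by linarith))
    (by rw [hα0, hk₁]; field_simp)
    (by rw [hα0, one_mul, Complex.conj_ofReal])
    (by rw [hl₁]; push_cast; ring)
  refine ⟨hRm, hRp, fun t => ?_, hαδ.1, ?_, fun hne => ?_⟩
  · simp only [hTime, eq_comm (a := t)]
    exact hTb.existsUnique t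
  · simp only [hδ]
    exact hαδ.2
  · have hσb := L.weierstrassSigma_ne_zero (hnotMem hb hne)
    have hsqrt' : (√((1 - e₂) / 2) : ℂ) ≠ 0 := by
      exact_mod_cast (Real.sqrt_pos.mpr (by linarith [lt_of_le_of_ne he2' hne])).ne'
    have hβγ := ToyTop.isGivenBy_sigmaQuotient (u := fun t => ToyTop.height (Φ t))
      (g := fun t => ToyTop.cayleyKlein A C n Φ t 1 0) (K := k₂) (ε := -1) (κ := (l - n) / A)
      (ν := l₃) hL hT0 hT hTime hx hb (hnotMem hb hne)
      (by rw [hk₂]; exact mul_ne_zero (mul_ne_zero Complex.I_ne_zero hsqrt') (div_ne_zero hσ₂ hσb))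
      (by linarith) (by rw [hwp]; ring)
      (fun t => by
        obtain ⟨f', h1, h2⟩ := hr.gamma t
        refine ⟨f', h1, ?_⟩
        push_cast at h2 ⊢
        linear_combination -h2)
      (fun t ht => by
        have h1 := (hnorm t).2
        rw [ht] at h1
        exact Complex.normSq_eq_zero.mp (by linarith))
      (by rw [hγ0, hk₂]; field_simp)
      (by rw [hγ0, map_mul, Complex.conj_ofReal, Complex.conj_I]; ring)
      (by rw [hl₃]; push_cast; ring)
    simp only [hβ]
    exact ⟨hβγ.2, hβγ.1⟩
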